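/- For a natural number $N$ consider the $2(2N+1)$-dimensional real vector space of closed plane curves $f=(x,y)\colon \mathbb R/2\pi\mathbb Z\to\mathbb R^2$ whose coordinates are trigonometric polynomials of degree at most $N$, $$x(\varphi)=a_0+\sum_{j=1}^N (a_j\cos j\varphi+b_j\sin j\varphi),\qquad y(\varphi)=\tilde a_0+\sum_{j=1}^N(\tilde a_j\cos j\varphi+\tilde b_j\sin j\varphi).$$ For an integer $r\ge 0$ equip it with the $W_2^r$ Euclidean structure $$\langle (x_1,y_1),(x_2,y_2)\rangle_r=\frac1\pi\int_0^{2\pi}\sum_{q=0}^r\left(x_1^{(q)}(\varphi)x_2^{(q)}(\varphi)+y_1^{(q)}(\varphi)y_2^{(q)}(\varphi)\right)d\varphi ,$$ and let $B_r(N)$ be its closed unit ball. Let $A_i(r,N)$ be the volume of the set of pairs $(f,g)\in B_r(N)\times B_r(N)$ whose images have exactly $i$ common points in the plane, divided by the volume of $B_r(N)\times B_r(N)$, and let $M_r(N)=\sum_{i\ge0} i\,A_i(r,N)$ be the average number of intersection points. Then: 1. $M_r(N)$ is finite for all $r\ge 1$ and all $N$, and there is a constant $c>0$ such that $M_1(N)=cN(1+o(1))$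 as $N\to\infty$. 2. For every integer $r\ge2$, $M_r(N)$ tends to a finite non-zero (positive) limit $L_r$ as $N\to\infty$. 3. As $r\to\infty$, $L_r=\dfrac{2\pi}{r}(1+o(1))$, and the limits decrease at the rate $L_r-L_{r+1}=\dfrac{2\pi}{r^2}(1+o(1))$. -/

import Mathlib

open Filter Topology MeasureTheory Asymptotics

/-- A real trigonometric polynomial of degree at most `N`, given by its coefficients: `p.1 j` is the
coefficient `a_j` of `cos (j φ)` for `0 ≤ j ≤ N`, and `p.2 j` is the coefficient `b_{j+1}` of
`sin ((j + 1) φ)` for `0 ≤ j < N`. -/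
abbrev TrigPoly (N : ℕ) : Type := (Fin (N + 1) → ℝ) × (Fin N → ℝ)

/-- The function defined by a trigonometric polynomial. -/
noncomputable def TrigPoly.eval {N : ℕ} (p : TrigPoly N) (φ : ℝ) : ℝ :=
  ∑ j : Fin (N + 1), p.1 j * Real.cos ((j : ℕ) * φ) +
    ∑ j : Fin N, p.2 j * Real.sin (((j : ℕ) + 1) * φ)

/-- A closed plane curve `φ ↦ (x φ, y φ)` whose coordinates `x = f.1`, `y = f.2` are trigonometric
polynomials of degree at most `N`. This is a real vector space of dimension `2 (2 N + 1)`. -/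
abbrev TrigCurve (N : ℕ) : Type := TrigPoly N × TrigPoly N

/-- The parametrization of the curve. It has period `2 π`, so it is a map from the circle, and the
image of the circle is `Set.range f.param`. -/
noncomputable def TrigCurve.param {N : ℕ} (f : TrigCurve N) (φ : ℝ) : ℝ × ℝ :=
  (TrigPoly.eval f.1 φ, TrigPoly.eval f.2 φ)

/-- The `W_2^r` dot product of two curves:
`(1 / π) ∫_0^{2π} ∑_{q = 0}^r (x₁^{(q)} x₂^{(q)} + y₁^{(q)} y₂^{(q)}) dφ`. -/
noncomputable def sobolevDot (r : ℕ) {N : ℕ} (f g : TrigCurve N) : ℝ :=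
  (1 / Real.pi) * ∫ φ in (0 : ℝ)..(2 * Real.pi), ∑ q ∈ Finset.range (r + 1),
    (iteratedDeriv q (TrigPoly.eval f.1) φ * iteratedDeriv q (TrigPoly.eval g.1) φ +
      iteratedDeriv q (TrigPoly.eval f.2) φ * iteratedDeriv q (TrigPoly.eval g.2) φ)

/-- The unit ball of the `W_2^r` metric in the space of curves. -/
def sobolevBall (r N : ℕ) : Set (TrigCurve N) := {f | sobolevDot r f f ≤ 1}

/-- The points of the plane that lie on both curves. -/
def intersectionPoints {N : ℕ} (f g : TrigCurve N) : Set (ℝ × ℝ) :=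
  Set.range (TrigCurve.param f) ∩ Set.range (TrigCurve.param g)

/-- The relative volume, in the space of pairs of curves from the unit ball of the `W_2^r` metric,
of the set of pairs with exactly `i` intersection points. The volume is Lebesgue measure in the
coefficients; the Euclidean volume of the `W_2^r` structure is a constant multiple of it, and the
constant cancels in the quotient. -/
noncomputable def relativeVolume (r N i : ℕ) : ENNReal :=
  volume {p : TrigCurve N × TrigCurve N | p ∈ sobolevBall r N ×ˢ sobolevBall r N ∧
      (intersectionPoints p.1 p.2).encard = (i : ℕ∞)} /
    volume (sobolevBall r N ×ˢ sobolevBall r N : Set (TrigCurve N × TrigCurve N))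

/-- The average number of intersection points of two curves of degree at most `N` from the unit ball
of the `W_2^r` metric. -/
noncomputable def averageIntersections (r N : ℕ) : ENNReal :=
  ∑' i : ℕ, (i : ENNReal) * relativeVolume r N i

section

open scoped ENNReal NNReal

/-- **Area formula** with multiplicities, for maps between spaces of equal dimension. -/
theorem exists_measurable_encard_fiber {E : Type*} [NormedAddCommGroup E] [NormedSpace ℝ E]
    [FiniteDimensional ℝ E] [MeasurableSpace E] [BorelSpace E] (μ : Measure E)
    [μ.IsAddHaarMeasure] {f : E → E} {f' : E → E →L[ℝ] E} {s : Set E}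
    (hf : ∀ x, HasFDerivAt f (f' x) x) (hf' : Continuous f') (hs : MeasurableSet s) :
    ∃ n : E → ℝ≥0∞, Measurable n ∧ (∀ᵐ y ∂μ, n y = ((s ∩ f ⁻¹' {y}).encard : ℝ≥0∞)) ∧
      ∀ g : E → ℝ≥0∞, Measurable g →
        ∫⁻ y, g y * n y ∂μ = ∫⁻ x in s, ENNReal.ofReal |(f' x).det| * g (f x) ∂μ := by
  classical
  have hfc : Continuous f := continuous_iff_continuousAt.2 fun x => (hf x).continuousAt
  have hdet : Continuous fun x => (f' x).det := ContinuousLinearMap.continuous_det.comp hf'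
  set s₀ : Set E := s ∩ {x | (f' x).det ≠ 0} with hs₀
  set s₁ : Set E := s ∩ {x | (f' x).det = 0} with hs₁
  have ms₀ : MeasurableSet s₀ :=
    hs.inter (hdet.measurable (measurableSet_singleton (0 : ℝ)).compl)
  have ms₁ : MeasurableSet s₁ := hs.inter (hdet.measurable (measurableSet_singleton (0 : ℝ)))
  let r : (E →L[ℝ] E) → ℝ≥0 := fun A =>
    if h : A.det ≠ 0 then
      (‖((A.toContinuousLinearEquivOfDetNeZero h).symm : E →L[ℝ] E)‖₊ + 1)⁻¹ else 1
  have hr : ∀ A, r A ≠ 0 := by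
    intro A
    by_cases h : A.det ≠ 0
    · simp only [r, h, dif_pos, ne_eq, not_false_eq_true]
      positivity
    · rw [show r A = 1 from dif_neg h]
      exact one_ne_zero
  obtain ⟨t, A, tdisj, tm, tcov, tapp, tA⟩ :=
    exists_partition_approximatesLinearOn_of_hasFDerivWithinAt f s₀ f'
      (fun x _ => (hf x).hasFDerivWithinAt) r hr
  have hinj : ∀ k, Set.InjOn f (s₀ ∩ t k) := by
    intro k
    rcases s₀.eq_empty_or_nonempty with he | hne
    · simp [he]
    obtain ⟨y, hy, hyA⟩ := tA hne k
    have hd : (A k).det ≠ 0 := by rw [hyA]; exact hy.2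
    have happ := tapp k
    have hr' : r (A k) =
        (‖(((A k).toContinuousLinearEquivOfDetNeZero hd).symm : E →L[ℝ] E)‖₊ + 1)⁻¹ := by
      simp only [r, hd, dif_pos, ne_eq, not_false_eq_true]
    rw [hr'] at happ
    have happ' : ApproximatesLinearOn f
        (((A k).toContinuousLinearEquivOfDetNeZero hd : E ≃L[ℝ] E) : E →L[ℝ] E) (s₀ ∩ t k)
        (‖(((A k).toContinuousLinearEquivOfDetNeZero hd).symm : E →L[ℝ] E)‖₊ + 1)⁻¹ := by
      exact happ
    refine happ'.injOn ?_
    rcases ((A k).toContinuousLinearEquivOfDetNeZero hd).subsingleton_or_nnnorm_symm_pos with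
      h | h
    · exact Or.inl h
    · right
      exact inv_strictAnti₀ h (lt_add_of_pos_right _ one_pos)
  have mt : ∀ k, MeasurableSet (s₀ ∩ t k) := fun k => ms₀.inter (tm k)
  have mim : ∀ k, MeasurableSet (f '' (s₀ ∩ t k)) := fun k =>
    measurable_image_of_fderivWithin (mt k) (fun x _ => (hf x).hasFDerivWithinAt) (hinj k)
  have hU : s₀ = ⋃ k, s₀ ∩ t k := by
    rw [← Set.inter_iUnion]
    exact (Set.inter_eq_left.2 tcov).symm
  have hdisj : Pairwise (Function.onFun Disjoint fun k => s₀ ∩ t k) := fun i j hij =>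
    (tdisj hij).mono Set.inter_subset_right Set.inter_subset_right
  refine ⟨fun y => ∑' k, (f '' (s₀ ∩ t k)).indicator 1 y, ?_, ?_, ?_⟩
  · exact Measurable.tsum fun k => measurable_one.indicator (mim k)
  · have h1 : μ (f '' s₁) = 0 :=
      addHaar_image_eq_zero_of_det_fderivWithin_eq_zero μ
        (fun x _ => (hf x).hasFDerivWithinAt) fun x hx => hx.2
    filter_upwards [measure_eq_zero_iff_ae_notMem.1 h1] with y hy
    have e1 : s ∩ f ⁻¹' {y} = ⋃ k, (s₀ ∩ t k) ∩ f ⁻¹' {y} := by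
      rw [← Set.iUnion_inter, ← hU]
      ext x
      simp only [Set.mem_inter_iff, Set.mem_preimage, Set.mem_singleton_iff, hs₀,
        Set.mem_ofPred_eq]
      constructor
      · rintro ⟨hx, hxy⟩
        exact ⟨⟨hx, fun h0 => hy ⟨x, ⟨hx, h0⟩, hxy⟩⟩, hxy⟩
      · rintro ⟨⟨hx, -⟩, hxy⟩
        exact ⟨hx, hxy⟩
    have mfy : MeasurableSet (f ⁻¹' {y}) := hfc.measurable (measurableSet_singleton y)
    rw [← Measure.count_apply (hs.inter mfy), e1,
      measure_iUnion (fun i j hij => (hdisj hij).mono Set.inter_subset_left Set.inter_subset_left)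
        fun k => (mt k).inter mfy]
    refine tsum_congr fun k => ?_
    rw [Measure.count_apply ((mt k).inter mfy)]
    by_cases hyk : y ∈ f '' (s₀ ∩ t k)
    · obtain ⟨x, hx, rfl⟩ := hyk
      have : s₀ ∩ t k ∩ f ⁻¹' {f x} = {x} := by
        ext z
        simp only [Set.mem_inter_iff, Set.mem_preimage, Set.mem_singleton_iff]
        constructor
        · rintro ⟨hz, hzx⟩
          exact hinj k hz hx hzx
        · rintro rfl
          exact ⟨hx, rfl⟩
      rw [this, Set.indicator_of_mem (Set.mem_image_of_mem f hx)]
      simp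
    · have : s₀ ∩ t k ∩ f ⁻¹' {y} = ∅ := by
        ext z
        simp only [Set.mem_inter_iff, Set.mem_preimage, Set.mem_singleton_iff,
          Set.mem_empty_iff_false, iff_false, not_and]
        intro hz hzy
        exact hyk ⟨z, hz, hzy⟩
      rw [this, Set.indicator_of_notMem hyk]
      simp
  · intro g hg
    have e2 : ∀ y, g y * ∑' k, (f '' (s₀ ∩ t k)).indicator (1 : E → ℝ≥0∞) y =
        ∑' k, (f '' (s₀ ∩ t k)).indicator g y := by
      intro y
      rw [← ENNReal.tsum_mul_left]
      refine tsum_congr fun k => ?_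
      by_cases hyk : y ∈ f '' (s₀ ∩ t k) <;> simp [hyk]
    simp_rw [e2]
    rw [lintegral_tsum fun k => (hg.indicator (mim k)).aemeasurable]
    have e3 : ∀ k, ∫⁻ y, (f '' (s₀ ∩ t k)).indicator g y ∂μ =
        ∫⁻ x in s₀ ∩ t k, ENNReal.ofReal |(f' x).det| * g (f x) ∂μ := by
      intro k
      rw [lintegral_indicator (mim k)]
      exact lintegral_image_eq_lintegral_abs_det_fderiv_mul μ (mt k)
        (fun x _ => (hf x).hasFDerivWithinAt) (hinj k) g
    simp_rw [e3]
    rw [← lintegral_iUnion mt hdisj, ← hU]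
    have hs01 : s = s₀ ∪ s₁ := by
      rw [hs₀, hs₁, ← Set.inter_union_distrib_left]
      refine (Set.inter_eq_left.2 fun x _ => ?_).symm
      simp only [Set.mem_union, Set.mem_ofPred_eq]
      tauto
    have hd01 : Disjoint s₀ s₁ := Set.disjoint_left.2 fun x hx hx' => hx.2 hx'.2
    conv_rhs => rw [hs01, lintegral_union ms₁ hd01]
    rw [setLIntegral_congr_fun (g := fun _ => 0) ms₁ fun x hx => by simp [hx.2.out]]
    simp

theorem lintegral_exp_neg_Ioi (a : ℝ) :
    ∫⁻ u in Set.Ioi a, ENNReal.ofReal (Real.exp (-u)) = ENNReal.ofReal (Real.exp (-a)) := by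
  rw [← integral_exp_neg_Ioi a, ofReal_integral_eq_lintegral_ofReal]
  · exact integrableOn_exp_neg_Ioi a
  · exact ae_of_all _ fun x => (Real.exp_pos _).le

theorem lintegral_exp_neg_mul_rpow {s : ℝ} (hs : 0 < s) :
    ∫⁻ u in Set.Ioi (0 : ℝ), ENNReal.ofReal (Real.exp (-u)) * ENNReal.ofReal (u ^ (s - 1)) =
      ENNReal.ofReal (Real.Gamma s) := by
  rw [Real.Gamma_eq_integral hs, ofReal_integral_eq_lintegral_ofReal]
  · exact lintegral_congr fun u => (ENNReal.ofReal_mul (Real.exp_pos _).le).symm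
  · exact Real.GammaIntegral_convergent hs
  · filter_upwards [ae_restrict_mem measurableSet_Ioi] with u hu
    exact mul_nonneg (Real.exp_pos _).le (Real.rpow_nonneg (le_of_lt hu) _)

theorem integral_abs_gaussianReal {R : ℝ} (hR : 0 ≤ R) :
    ∫⁻ x, ENNReal.ofReal |x| ∂(ProbabilityTheory.gaussianReal 0 (R / 2).toNNReal) =
      ENNReal.ofReal √(R / Real.pi) := by
  rcases hR.eq_or_lt with rfl | hR
  · simp [ProbabilityTheory.gaussianReal_zero_var]
  have hv : (R / 2).toNNReal ≠ 0 := by simpa using hR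
  rw [ProbabilityTheory.gaussianReal_of_var_ne_zero _ hv,
    lintegral_withDensity_eq_lintegral_mul _ (ProbabilityTheory.measurable_gaussianPDF _ _)
      (by fun_prop)]
  have hc : ((R / 2).toNNReal : ℝ) = R / 2 := Real.coe_toNNReal _ (by positivity)
  have e : ∀ x : ℝ, (ProbabilityTheory.gaussianPDF 0 (R / 2).toNNReal *
      fun x => ENNReal.ofReal |x|) x =
      ENNReal.ofReal ((√(Real.pi * R))⁻¹ * (|x| * Real.exp (-(1 / R) * |x| ^ 2))) := by
    intro x
    simp only [Pi.mul_apply, ProbabilityTheory.gaussianPDF, ProbabilityTheory.gaussianPDFReal, hc]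
    rw [← ENNReal.ofReal_mul (by positivity), sq_abs]
    congr 1
    have h1 : 2 * Real.pi * (R / 2) = Real.pi * R := by ring
    have h2 : -(x - 0) ^ 2 / (2 * (R / 2)) = -(1 / R) * x ^ 2 := by field_simp; ring
    rw [h1, h2]
    ring
  rw [lintegral_congr e, ← ofReal_integral_eq_lintegral_ofReal]
  · congr 1
    rw [integral_const_mul,
      integral_comp_abs (f := fun x => x * Real.exp (-(1 / R) * x ^ 2))]
    have h3 := integral_rpow_mul_exp_neg_mul_rpow (p := 2) (q := 1) (b := 1 / R) two_pos
      (by norm_num) (by positivity)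
    have h4 : ∫ x in Set.Ioi (0 : ℝ), x * Real.exp (-(1 / R) * x ^ 2) = R / 2 := by
      have : ∀ x : ℝ, x ^ (1 : ℝ) * Real.exp (-(1 / R) * x ^ (2 : ℝ)) =
          x * Real.exp (-(1 / R) * x ^ 2) := by
        intro x
        rw [Real.rpow_one, Real.rpow_two]
      simp_rw [this] at h3
      rw [h3]
      norm_num
      rw [Real.rpow_neg_one, inv_inv]
      ring
    rw [h4, Real.sqrt_div hR.le, Real.sqrt_mul Real.pi_pos.le]
    have := Real.mul_self_sqrt hR.le
    field_simp
    nlinarith [this]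
  · refine Integrable.const_mul ?_ _
    have := (integrable_mul_exp_neg_mul_sq (b := 1 / R) (by positivity)).abs
    refine this.congr (ae_of_all _ fun x => ?_)
    simp [abs_mul, Real.abs_exp]
  · exact ae_of_all _ fun x => by positivity

theorem lintegral_abs_of_gaussian_translate {E : Type*} [AddCommGroup E] [Module ℝ E]
    [MeasurableSpace E] [MeasurableAdd E] (μ : Measure E) [μ.IsAddRightInvariant] {q l : E → ℝ}
    (hq : Measurable q) (hl : Measurable l) {v : E} {R : ℝ} (hR : 0 ≤ R)
    (hqv : ∀ (t : ℝ) (x : E), q (x + t • v) = q x + 2 * t * l x + t ^ 2 * R)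
    (h0 : ∫⁻ x, ENNReal.ofReal (Real.exp (-q x)) ∂μ ≠ 0)
    (htop : ∫⁻ x, ENNReal.ofReal (Real.exp (-q x)) ∂μ ≠ ∞) :
    ∫⁻ x, ENNReal.ofReal (Real.exp (-q x)) * ENNReal.ofReal |l x| ∂μ =
      (∫⁻ x, ENNReal.ofReal (Real.exp (-q x)) ∂μ) * ENNReal.ofReal √(R / Real.pi) := by
  set Z := ∫⁻ x, ENNReal.ofReal (Real.exp (-q x)) ∂μ with hZ
  have mw : Measurable fun x => ENNReal.ofReal (Real.exp (-q x)) := by fun_prop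
  set ν : Measure E := Z⁻¹ • μ.withDensity fun x => ENNReal.ofReal (Real.exp (-q x)) with hν
  have hint : ∀ g : E → ℝ≥0∞, Measurable g →
      ∫⁻ x, g x ∂ν = Z⁻¹ * ∫⁻ x, ENNReal.ofReal (Real.exp (-q x)) * g x ∂μ := by
    intro g hg
    rw [hν, lintegral_smul_measure, lintegral_withDensity_eq_lintegral_mul _ mw hg]
    rfl
  have hprob : IsProbabilityMeasure ν := by
    constructor
    have := hint (fun _ => 1) measurable_const
    rw [lintegral_one] at this
    rw [this]
    simp only [mul_one]
    exact ENNReal.inv_mul_cancel h0 htop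
  have hmgf : ∀ t : ℝ, ∫⁻ x, ENNReal.ofReal (Real.exp (t * l x)) ∂ν =
      ENNReal.ofReal (Real.exp ((R / 2) * t ^ 2 / 2)) := by
    intro t
    rw [hint _ (by fun_prop)]
    have e : ∀ x, ENNReal.ofReal (Real.exp (-q x)) * ENNReal.ofReal (Real.exp (t * l x)) =
        ENNReal.ofReal (Real.exp ((R / 2) * t ^ 2 / 2)) *
          ENNReal.ofReal (Real.exp (-q (x + (-(t / 2)) • v))) := by
      intro x
      rw [← ENNReal.ofReal_mul (Real.exp_pos _).le, ← ENNReal.ofReal_mul (Real.exp_pos _).le,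
        ← Real.exp_add, ← Real.exp_add, hqv]
      congr 2
      ring
    rw [lintegral_congr e, lintegral_const_mul _ (by exact mw.comp (measurable_add_const ((-(t / 2)) • v))),
      lintegral_add_right_eq_self (fun x => ENNReal.ofReal (Real.exp (-q x))) ((-(t / 2)) • v),
      ← hZ, mul_comm _ Z, ← mul_assoc, ENNReal.inv_mul_cancel h0 htop, one_mul]
  have hRv : ((R / 2).toNNReal : ℝ) = R / 2 := Real.coe_toNNReal _ (by positivity)
  have hmgf' : ProbabilityTheory.mgf l ν =
      ProbabilityTheory.mgf id (ProbabilityTheory.gaussianReal 0 (R / 2).toNNReal) := by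
    rw [ProbabilityTheory.mgf_id_gaussianReal]
    funext t
    rw [ProbabilityTheory.mgf, integral_eq_lintegral_of_nonneg_ae
      (ae_of_all _ fun x => (Real.exp_pos _).le) (by fun_prop), hmgf,
      ENNReal.toReal_ofReal (Real.exp_pos _).le, hRv]
    simp
  have hset : ProbabilityTheory.integrableExpSet l ν = Set.univ := by
    rw [ProbabilityTheory.integrableExpSet_eq_of_mgf hmgf',
      ProbabilityTheory.integrableExpSet_id_gaussianReal]
  have hlaw : ν.map l = ProbabilityTheory.gaussianReal 0 (R / 2).toNNReal := by
    have := Measure.ext_of_complexMGF_eq hl.aemeasurable aemeasurable_id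
      (funext fun z => ProbabilityTheory.eqOn_complexMGF_of_mgf hmgf' (x := z) (by simp [hset]))
    simpa using this
  have key : ∫⁻ x, ENNReal.ofReal |l x| ∂ν = ENNReal.ofReal √(R / Real.pi) := by
    rw [← integral_abs_gaussianReal hR, ← hlaw, lintegral_map (by fun_prop) hl]
  rw [hint _ (by fun_prop)] at key
  rw [← key, ← mul_assoc, ENNReal.mul_inv_cancel h0 htop, one_mul]

section Homogeneous

variable {E : Type*} [NormedAddCommGroup E] [NormedSpace ℝ E] [FiniteDimensional ℝ E]
  [MeasurableSpace E] [BorelSpace E] (μ : Measure E) [μ.IsAddHaarMeasure]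

theorem lintegral_comp_smul_of_pos {F : E → ℝ≥0∞} (hF : Measurable F) {ρ : ℝ} (hρ : 0 < ρ) :
    ∫⁻ x, F x ∂μ =
      ENNReal.ofReal (ρ ^ Module.finrank ℝ E) * ∫⁻ x, F (ρ • x) ∂μ := by
  have h := Measure.map_addHaar_smul μ hρ.ne'
  have h2 : ∫⁻ x, F (ρ • x) ∂μ = ∫⁻ x, F x ∂(μ.map (ρ • ·)) :=
    (lintegral_map hF (measurable_const_smul ρ)).symm
  rw [h2, h, lintegral_smul_measure, smul_eq_mul, ← mul_assoc, abs_of_pos (by positivity),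
    ← ENNReal.ofReal_mul (by positivity), mul_inv_cancel₀ (by positivity), ENNReal.ofReal_one,
    one_mul]

variable {q : E → ℝ} {f : E → ℝ≥0∞} {d : ℕ}

theorem lintegral_sublevel_of_homogeneous (hq : Measurable q) (hf : Measurable f)
    (hqs : ∀ c : ℝ, 0 < c → ∀ x, q (c • x) = c ^ 2 * q x)
    (hfs : ∀ c : ℝ, 0 < c → ∀ x, f (c • x) = ENNReal.ofReal (c ^ d) * f x)
    {R : ℝ} (hR : 0 < R) :
    ∫⁻ x in {x | q x ≤ R}, f x ∂μ =
      ENNReal.ofReal (R ^ (((Module.finrank ℝ E + d : ℕ) : ℝ) / 2)) *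
        ∫⁻ x in {x | q x ≤ 1}, f x ∂μ := by
  have hm : ∀ a : ℝ, MeasurableSet {x | q x ≤ a} := fun a => measurableSet_le hq measurable_const
  rw [← lintegral_indicator (hm R), ← lintegral_indicator (hm 1),
    lintegral_comp_smul_of_pos μ (hf.indicator (hm R)) (Real.sqrt_pos.2 hR)]
  have e : ∀ x, ({x | q x ≤ R} : Set E).indicator f (√R • x) =
      ENNReal.ofReal (√R ^ d) * ({x | q x ≤ 1} : Set E).indicator f x := by
    intro x
    have h1 : (√R • x ∈ {x | q x ≤ R}) ↔ x ∈ {x | q x ≤ 1} := by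
      simp only [Set.mem_ofPred_eq]
      rw [hqs _ (Real.sqrt_pos.2 hR), Real.sq_sqrt hR.le]
      constructor
      · intro h
        nlinarith
      · intro h
        nlinarith
    by_cases hx : x ∈ {x | q x ≤ 1}
    · rw [Set.indicator_of_mem hx, Set.indicator_of_mem (h1.2 hx), hfs _ (Real.sqrt_pos.2 hR)]
    · rw [Set.indicator_of_notMem hx, Set.indicator_of_notMem (fun h => hx (h1.1 h)), mul_zero]
  rw [lintegral_congr e, lintegral_const_mul _ (hf.indicator (hm 1)), ← mul_assoc,
    ← ENNReal.ofReal_mul (by positivity), ← pow_add]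
  congr 2
  rw [Real.sqrt_eq_rpow, ← Real.rpow_natCast, ← Real.rpow_mul hR.le]
  congr 1
  ring

theorem lintegral_exp_neg_of_homogeneous (hq : Measurable q) (hf : Measurable f)
    (hq0 : ∀ x, 0 ≤ q x)
    (hqs : ∀ c : ℝ, 0 < c → ∀ x, q (c • x) = c ^ 2 * q x)
    (hfs : ∀ c : ℝ, 0 < c → ∀ x, f (c • x) = ENNReal.ofReal (c ^ d) * f x) :
    ∫⁻ x, ENNReal.ofReal (Real.exp (-q x)) * f x ∂μ =
      ENNReal.ofReal (Real.Gamma (((Module.finrank ℝ E + d : ℕ) : ℝ) / 2 + 1)) *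
        ∫⁻ x in {x | q x ≤ 1}, f x ∂μ := by
  have hm : ∀ a : ℝ, MeasurableSet {x | q x ≤ a} := fun a => measurableSet_le hq measurable_const
  have e1 : ∀ x, ENNReal.ofReal (Real.exp (-q x)) * f x =
      ∫⁻ u in Set.Ici (0 : ℝ), ENNReal.ofReal (Real.exp (-u)) *
        ({p : E × ℝ | q p.1 ≤ p.2} : Set (E × ℝ)).indicator (fun p => f p.1) (x, u) := by
    intro x
    have : ∀ u : ℝ, ENNReal.ofReal (Real.exp (-u)) *
        ({p : E × ℝ | q p.1 ≤ p.2} : Set (E × ℝ)).indicator (fun p => f p.1) (x, u) =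
        (Set.Ici (q x)).indicator (fun u => ENNReal.ofReal (Real.exp (-u)) * f x) u := by
      intro u
      by_cases h : q x ≤ u <;> simp [h]
    rw [lintegral_congr this, lintegral_indicator measurableSet_Ici,
      Measure.restrict_restrict measurableSet_Ici,
      Set.inter_eq_left.2 (Set.Ici_subset_Ici.2 (hq0 x)), lintegral_mul_const _ (by fun_prop),
      ← setLIntegral_congr Ioi_ae_eq_Ici, lintegral_exp_neg_Ioi]
  have mS : MeasurableSet {p : E × ℝ | q p.1 ≤ p.2} :=
    measurableSet_le (hq.comp measurable_fst) measurable_snd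
  have mI : Measurable (({p : E × ℝ | q p.1 ≤ p.2} : Set (E × ℝ)).indicator (fun p => f p.1)) :=
    (hf.comp measurable_fst).indicator mS
  rw [lintegral_congr e1, lintegral_lintegral_swap, ← setLIntegral_congr Ioi_ae_eq_Ici]
  · have e2 : ∀ u ∈ Set.Ioi (0 : ℝ), ∫⁻ x, ENNReal.ofReal (Real.exp (-u)) *
        ({p : E × ℝ | q p.1 ≤ p.2} : Set (E × ℝ)).indicator (fun p => f p.1) (x, u) ∂μ =
        ENNReal.ofReal (Real.exp (-u)) *
          ENNReal.ofReal (u ^ ((((Module.finrank ℝ E + d : ℕ) : ℝ) / 2 + 1) - 1)) *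
          ∫⁻ x in {x | q x ≤ 1}, f x ∂μ := by
      intro u hu
      rw [lintegral_const_mul _ (by exact mI.comp measurable_prodMk_right), mul_assoc,
        add_sub_cancel_right, ← lintegral_sublevel_of_homogeneous μ hq hf hqs hfs hu,
        ← lintegral_indicator (hm u)]
      rfl
    rw [setLIntegral_congr_fun measurableSet_Ioi e2, lintegral_mul_const _ (by fun_prop),
      lintegral_exp_neg_mul_rpow (by positivity)]
  · refine Measurable.aemeasurable ?_
    exact (by fun_prop : Measurable fun p : E × ℝ => ENNReal.ofReal (Real.exp (-p.2))).mul mI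

end Homogeneous

theorem integral_mul_one_sub_sq_pow {P : ℝ} (hP : 0 < P) (k : ℕ) :
    ∫ r in (0 : ℝ)..√P, r * (1 - r ^ 2 / P) ^ k = P / (2 * (k + 1)) := by
  have h : ∀ r ∈ Set.uIcc 0 √P, HasDerivAt
      (fun r : ℝ => -(P / (2 * (k + 1))) * (1 - r ^ 2 / P) ^ (k + 1))
      (r * (1 - r ^ 2 / P) ^ k) r := by
    intro r _
    have h1 : HasDerivAt (fun r : ℝ => 1 - r ^ 2 / P) (-(2 * r / P)) r := by
      have := ((hasDerivAt_pow 2 r).div_const P).const_sub 1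
      simpa using this
    have h2 := (h1.pow (k + 1)).const_mul (-(P / (2 * ((k : ℝ) + 1))))
    refine h2.congr_deriv ?_
    push_cast
    field_simp
  rw [intervalIntegral.integral_eq_sub_of_hasDerivAt h
    (Continuous.intervalIntegrable (by fun_prop) _ _), Real.sq_sqrt hP.le]
  simp [hP.ne']

theorem lintegral_pow_max_one_sub_norm_sq {P : ℝ} (hP : 0 < P) {k : ℕ} (hk : k ≠ 0) :
    ∫⁻ w : ℝ × ℝ, ENNReal.ofReal (max 0 (1 - (w.1 ^ 2 + w.2 ^ 2) / P) ^ k) =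
      ENNReal.ofReal (Real.pi * P / (k + 1)) := by
  rw [← lintegral_comp_polarCoord_symm, polarCoord_target, Measure.volume_eq_prod,
    ← Measure.prod_restrict]
  have e : ∀ p : ℝ × ℝ, ENNReal.ofReal p.1 •
      ENNReal.ofReal (max 0 (1 - ((polarCoord.symm p).1 ^ 2 + (polarCoord.symm p).2 ^ 2) / P) ^ k)
      = ENNReal.ofReal p.1 * ENNReal.ofReal (max 0 (1 - p.1 ^ 2 / P) ^ k) := by
    intro p
    rw [polarCoord_symm_apply, smul_eq_mul]
    have : (p.1 * Real.cos p.2) ^ 2 + (p.1 * Real.sin p.2) ^ 2 = p.1 ^ 2 := by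
      linear_combination p.1 ^ 2 * Real.sin_sq_add_cos_sq p.2
    simp only [this]
  rw [lintegral_congr e, lintegral_prod _ (by fun_prop)]
  simp only [lintegral_const, Measure.restrict_apply_univ, Real.volume_Ioo]
  rw [lintegral_mul_const _ (by fun_prop)]
  have h1 : ∫⁻ r in Set.Ioi (0 : ℝ), ENNReal.ofReal r * ENNReal.ofReal (max 0 (1 - r ^ 2 / P) ^ k)
      = ENNReal.ofReal (P / (2 * (k + 1))) := by
    rw [← integral_mul_one_sub_sq_pow hP k, intervalIntegral.integral_of_le (Real.sqrt_nonneg P),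
      ofReal_integral_eq_lintegral_ofReal]
    · rw [← lintegral_indicator measurableSet_Ioi, ← lintegral_indicator measurableSet_Ioc]
      refine lintegral_congr fun r => ?_
      by_cases h0 : 0 < r
      · by_cases h2 : r ≤ √P
        · have h3 : r ^ 2 / P ≤ 1 := by
            rw [div_le_one hP]
            calc r ^ 2 ≤ √P ^ 2 := by gcongr
              _ = P := Real.sq_sqrt hP.le
          rw [Set.indicator_of_mem (Set.mem_Ioi.2 h0), Set.indicator_of_mem (Set.mem_Ioc.2 ⟨h0, h2⟩),
            ENNReal.ofReal_mul h0.le, max_eq_right (by linarith)]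
        · have h3 : 1 ≤ r ^ 2 / P := by
            rw [one_le_div hP]
            calc P = √P ^ 2 := (Real.sq_sqrt hP.le).symm
              _ ≤ r ^ 2 := by
                gcongr
                exact le_of_not_ge h2
          rw [Set.indicator_of_mem (Set.mem_Ioi.2 h0),
            Set.indicator_of_notMem fun h => h2 h.2, max_eq_left (by linarith), zero_pow hk]
          simp
      · rw [Set.indicator_of_notMem (by simpa using h0), Set.indicator_of_notMem fun h => h0 h.1]
    · exact (Continuous.intervalIntegrable (by fun_prop) 0 (√P)).1
    · filter_upwards [ae_restrict_mem measurableSet_Ioc] with r hr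
      have h3 : r ^ 2 / P ≤ 1 := by
        rw [div_le_one hP]
        calc r ^ 2 ≤ √P ^ 2 := by
              have := hr.1.le
              have := hr.2
              gcongr
          _ = P := Real.sq_sqrt hP.le
      exact mul_nonneg hr.1.le (pow_nonneg (by linarith) _)
  rw [h1, ← ENNReal.ofReal_mul (by positivity)]
  congr 1
  field_simp
  ring

theorem integral_abs_cos : ∫ θ in (0 : ℝ)..2 * Real.pi, |Real.cos θ| = 4 := by
  have hper : Function.Periodic (fun θ => |Real.cos θ|) Real.pi := fun θ => by
    simp [Real.cos_add_pi]
  have hI : ∀ a b : ℝ, IntervalIntegrable (fun θ => |Real.cos θ|) volume a b := fun a b =>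
    Continuous.intervalIntegrable (by fun_prop) _ _
  have h1 : ∀ t, ∫ θ in t..t + Real.pi, |Real.cos θ| = 2 := by
    intro t
    rw [hper.intervalIntegral_add_eq t (-(Real.pi / 2)),
      intervalIntegral.integral_congr (g := Real.cos)]
    · rw [integral_cos, show -(Real.pi / 2) + Real.pi = Real.pi / 2 by ring]
      norm_num
    · intro θ hθ
      rw [Set.uIcc_of_le (by linarith [Real.pi_pos])] at hθ
      exact abs_of_nonneg (Real.cos_nonneg_of_mem_Icc ⟨hθ.1, by linarith [hθ.2]⟩)
  rw [← intervalIntegral.integral_add_adjacent_intervals (hI 0 Real.pi) (hI _ _)]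
  have h2 := h1 0
  have h3 := h1 Real.pi
  rw [zero_add] at h2
  rw [← two_mul] at h3
  rw [h2, h3]
  norm_num

theorem lintegral_abs_cos_add_sin (x y : ℝ) :
    ∫⁻ θ in Set.Ioc 0 (2 * Real.pi), ENNReal.ofReal |Real.cos θ * x + Real.sin θ * y| =
      ENNReal.ofReal (4 * √(x ^ 2 + y ^ 2)) := by
  have hpi : (0 : ℝ) ≤ 2 * Real.pi := by positivity
  set α := Complex.arg ⟨x, y⟩ with hα
  have hn : ‖(⟨x, y⟩ : ℂ)‖ = √(x ^ 2 + y ^ 2) := by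
    rw [Complex.norm_def, Complex.normSq_mk, ← sq, ← sq]
  have hx : √(x ^ 2 + y ^ 2) * Real.cos α = x := by
    rw [← hn]; exact Complex.norm_mul_cos_arg ⟨x, y⟩
  have hy : √(x ^ 2 + y ^ 2) * Real.sin α = y := by
    rw [← hn]; exact Complex.norm_mul_sin_arg ⟨x, y⟩
  have e : ∀ θ, |Real.cos θ * x + Real.sin θ * y| =
      √(x ^ 2 + y ^ 2) * |Real.cos (θ - α)| := by
    intro θ
    have : Real.cos θ * x + Real.sin θ * y = √(x ^ 2 + y ^ 2) * Real.cos (θ - α) := by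
      rw [Real.cos_sub]
      linear_combination (-Real.cos θ) * hx - Real.sin θ * hy
    rw [this, abs_mul, abs_of_nonneg (Real.sqrt_nonneg _)]
  rw [← ofReal_integral_eq_lintegral_ofReal, ← intervalIntegral.integral_of_le hpi]
  · congr 1
    simp_rw [e]
    rw [intervalIntegral.integral_const_mul,
      intervalIntegral.integral_comp_sub_right (fun θ => |Real.cos θ|) α]
    have hper : Function.Periodic (fun θ => |Real.cos θ|) (2 * Real.pi) := fun θ => by
      simp [Real.cos_add_two_pi]
    have h := hper.intervalIntegral_add_eq (0 - α) 0
    rw [show 0 - α + 2 * Real.pi = 2 * Real.pi - α by ring, zero_add, integral_abs_cos] at h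
    rw [h]
    ring
  · exact (Continuous.intervalIntegrable (by fun_prop) 0 (2 * Real.pi)).1
  · exact ae_of_all _ fun θ => abs_nonneg _

theorem lintegral_exp_neg_sq_div {a : ℝ} (ha : 0 < a) :
    ∫⁻ c : ℝ, ENNReal.ofReal (Real.exp (-(c ^ 2 / a))) = ENNReal.ofReal √(Real.pi * a) := by
  have e : ∀ c : ℝ, Real.exp (-(c ^ 2 / a)) = Real.exp (-(1 / a) * c ^ 2) := fun c => by
    congr 1; ring
  simp_rw [e]
  rw [← ofReal_integral_eq_lintegral_ofReal (integrable_exp_neg_mul_sq (by positivity))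
    (ae_of_all _ fun x => (Real.exp_pos _).le), integral_gaussian]
  congr 2
  field_simp

section QuadraticForm

variable {H : Type*} [NormedAddCommGroup H] [InnerProductSpace ℝ H]

/-- The squared length of `z` after the constant term is chosen so that the curve passes through
the origin: `⟪a, z⟫² / κ + ‖z‖²`. -/
noncomputable def sliceForm (κ : ℝ) (a z : H) : ℝ := inner ℝ a z ^ 2 / κ + ‖z‖ ^ 2

theorem sliceForm_nonneg {κ : ℝ} (hκ : 0 < κ) (a z : H) : 0 ≤ sliceForm κ a z := by
  unfold sliceForm
  positivity

theorem sliceForm_smul (κ : ℝ) (a z : H) (c : ℝ) :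
    sliceForm κ a (c • z) = c ^ 2 * sliceForm κ a z := by
  rw [sliceForm, sliceForm, inner_smul_right, norm_smul, Real.norm_eq_abs, mul_pow, mul_pow, sq_abs]
  ring

theorem eq_zero_of_sliceForm_nonpos {κ : ℝ} (hκ : 0 < κ) {a z : H} (h : sliceForm κ a z ≤ 0) :
    z = 0 := by
  have h1 : 0 ≤ inner ℝ a z ^ 2 / κ := by positivity
  have h2 : ‖z‖ ^ 2 ≤ 0 := by
    unfold sliceForm at h
    linarith
  simpa using le_antisymm h2 (sq_nonneg _)

theorem continuous_sliceForm (κ : ℝ) (a : H) : Continuous (sliceForm κ a) := by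
  unfold sliceForm
  fun_prop

theorem sliceForm_add_smul {κ : ℝ} {a b : H} (hab : inner ℝ a b = 0) (t : ℝ) (z : H) :
    sliceForm κ a (z + t • b) =
      sliceForm κ a z + 2 * t * inner ℝ b z + t ^ 2 * ‖b‖ ^ 2 := by
  unfold sliceForm
  rw [inner_add_right, inner_smul_right, hab, norm_add_sq_real, norm_smul, inner_smul_right,
    Real.norm_eq_abs, mul_pow, sq_abs, real_inner_comm b z]
  ring

theorem sq_sub_inner_div_add_norm_sq {κ P : ℝ} (hκ : 0 < κ) {a : H} (hP : κ + ‖a‖ ^ 2 = P)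
    (w : ℝ) (z : H) :
    (w - inner ℝ a (z + (w / P) • a)) ^ 2 / κ + ‖z + (w / P) • a‖ ^ 2 =
      w ^ 2 / P + sliceForm κ a z := by
  have hP0 : 0 < P := by
    rw [← hP]; positivity
  have ha : ‖a‖ ^ 2 = P - κ := by linarith
  unfold sliceForm
  rw [inner_add_right, inner_smul_right, norm_add_sq_real, norm_smul, inner_smul_right,
    Real.norm_eq_abs, mul_pow, sq_abs, real_inner_self_eq_norm_sq, ha, real_inner_comm]
  field_simp
  ring

variable [FiniteDimensional ℝ H] [MeasurableSpace H] [BorelSpace H]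

/-- The total mass of the Gaussian weight attached to `sliceForm`. -/
noncomputable def sliceMass (κ : ℝ) (a : H) : ℝ≥0∞ :=
  ∫⁻ z : H, ENNReal.ofReal (Real.exp (-sliceForm κ a z))

theorem lintegral_exp_neg_norm_sq :
    ∫⁻ z : H, ENNReal.ofReal (Real.exp (-‖z‖ ^ 2)) =
      ENNReal.ofReal (Real.pi ^ ((Module.finrank ℝ H : ℝ) / 2)) := by
  have h := GaussianFourier.integral_rexp_neg_mul_sq_norm (V := H) (b := 1) one_pos
  have e : ∀ z : H, Real.exp (-1 * ‖z‖ ^ 2) = Real.exp (-‖z‖ ^ 2) := fun z => by congr 1; ring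
  simp_rw [e, div_one] at h
  rw [← h, ofReal_integral_eq_lintegral_ofReal]
  · by_contra hni
    rw [integral_undef hni] at h
    exact (Real.rpow_pos_of_pos Real.pi_pos _).ne h
  · exact ae_of_all _ fun x => (Real.exp_pos _).le

theorem sliceMass_mul {κ P : ℝ} (hκ : 0 < κ) {a : H} (hP : κ + ‖a‖ ^ 2 = P) :
    ENNReal.ofReal √(Real.pi * P) * sliceMass κ a =
      ENNReal.ofReal √(Real.pi * κ) *
        ENNReal.ofReal (Real.pi ^ ((Module.finrank ℝ H : ℝ) / 2)) := by
  have hP0 : 0 < P := by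
    rw [← hP]; positivity
  have hc := continuous_sliceForm κ a
  have hm := hc.measurable
  have e1 : ∀ w : ℝ, ENNReal.ofReal (Real.exp (-(w ^ 2 / P))) * sliceMass κ a =
      ∫⁻ z : H, ENNReal.ofReal (Real.exp (-((w - inner ℝ a z) ^ 2 / κ + ‖z‖ ^ 2))) := by
    intro w
    rw [← lintegral_add_right_eq_self _ ((w / P) • a), sliceMass, ← lintegral_const_mul _
      (by fun_prop)]
    refine lintegral_congr fun z => ?_
    rw [← ENNReal.ofReal_mul (Real.exp_pos _).le, ← Real.exp_add,
      sq_sub_inner_div_add_norm_sq hκ hP, neg_add]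
  rw [← lintegral_exp_neg_sq_div hP0, ← lintegral_mul_const _ (by fun_prop), lintegral_congr e1,
    lintegral_lintegral_swap (by fun_prop), ← lintegral_exp_neg_norm_sq,
    ← lintegral_const_mul _ (by fun_prop)]
  refine lintegral_congr fun z => ?_
  rw [lintegral_sub_right_eq_self
    (fun w => ENNReal.ofReal (Real.exp (-(w ^ 2 / κ + ‖z‖ ^ 2)))) (inner ℝ a z),
    ← lintegral_exp_neg_sq_div hκ, ← lintegral_mul_const _ (by fun_prop)]
  refine lintegral_congr fun w => ?_
  rw [← ENNReal.ofReal_mul (Real.exp_pos _).le, ← Real.exp_add, neg_add]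

theorem sliceMass_ne_zero {κ : ℝ} (hκ : 0 < κ) (a : H) : sliceMass κ a ≠ 0 := by
  intro h
  have := sliceMass_mul hκ (rfl : κ + ‖a‖ ^ 2 = _)
  rw [h, mul_zero, ← ENNReal.ofReal_mul (by positivity), eq_comm, ENNReal.ofReal_eq_zero] at this
  exact absurd this (not_le.2 (by positivity))

theorem sliceMass_ne_top {κ : ℝ} (hκ : 0 < κ) (a : H) : sliceMass κ a ≠ ∞ := by
  intro h
  have h2 := sliceMass_mul hκ (rfl : κ + ‖a‖ ^ 2 = _)
  have hpos : 0 < √(Real.pi * (κ + ‖a‖ ^ 2)) := by positivity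
  rw [h, ENNReal.mul_top (by simpa using hpos), ← ENNReal.ofReal_mul (by positivity)] at h2
  exact ENNReal.ofReal_ne_top h2.symm

theorem lintegral_exp_neg_sliceForm_prod (κ : ℝ) (a : H) :
    ∫⁻ p : H × H, ENNReal.ofReal (Real.exp (-(sliceForm κ a p.1 + sliceForm κ a p.2))) =
      sliceMass κ a ^ 2 := by
  have hm := (continuous_sliceForm κ a).measurable
  have e : ∀ p : H × H, ENNReal.ofReal (Real.exp (-(sliceForm κ a p.1 + sliceForm κ a p.2))) =
      ENNReal.ofReal (Real.exp (-sliceForm κ a p.1)) *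
        ENNReal.ofReal (Real.exp (-sliceForm κ a p.2)) := fun p => by
    rw [← ENNReal.ofReal_mul (Real.exp_pos _).le, ← Real.exp_add, neg_add]
  rw [lintegral_congr e, Measure.volume_eq_prod, sq, sliceMass]
  exact lintegral_prod_mul (f := fun z => ENNReal.ofReal (Real.exp (-sliceForm κ a z)))
    (g := fun z => ENNReal.ofReal (Real.exp (-sliceForm κ a z))) (by fun_prop) (by fun_prop)

theorem lintegral_exp_neg_sliceForm_mul_abs {κ : ℝ} (hκ : 0 < κ) {a b : H}
    (hab : inner ℝ a b = 0) (s t : ℝ) :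
    ∫⁻ p : H × H, ENNReal.ofReal (Real.exp (-(sliceForm κ a p.1 + sliceForm κ a p.2))) *
        ENNReal.ofReal |s * inner ℝ b p.1 + t * inner ℝ b p.2| =
      sliceMass κ a ^ 2 * ENNReal.ofReal √((s ^ 2 + t ^ 2) * ‖b‖ ^ 2 / Real.pi) := by
  have hm := (continuous_sliceForm κ a).measurable
  have hmass := lintegral_exp_neg_sliceForm_prod κ a
  rw [← hmass]
  have : (volume : Measure (H × H)).IsAddRightInvariant :=
    inferInstanceAs ((volume : Measure H).prod volume).IsAddRightInvariant
  refine lintegral_abs_of_gaussian_translate volume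
    (q := fun p : H × H => sliceForm κ a p.1 + sliceForm κ a p.2)
    (l := fun p : H × H => s * inner ℝ b p.1 + t * inner ℝ b p.2)
    (v := (s • b, t • b)) (by fun_prop) (by fun_prop) (by positivity) ?_ ?_ ?_
  · rintro τ ⟨x, y⟩
    simp only [Prod.smul_mk, Prod.mk_add_mk, smul_smul]
    rw [sliceForm_add_smul hab, sliceForm_add_smul hab]
    ring
  · rw [hmass]
    exact pow_ne_zero _ (sliceMass_ne_zero hκ a)
  · rw [hmass]
    exact ENNReal.pow_ne_top (sliceMass_ne_top hκ a)

theorem lintegral_exp_neg_sliceForm_mul_sqrt {κ : ℝ} (hκ : 0 < κ) {a b : H}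
    (hab : inner ℝ a b = 0) :
    ∫⁻ p : H × H, ENNReal.ofReal (Real.exp (-(sliceForm κ a p.1 + sliceForm κ a p.2))) *
        ENNReal.ofReal √(inner ℝ b p.1 ^ 2 + inner ℝ b p.2 ^ 2) =
      sliceMass κ a ^ 2 * ENNReal.ofReal (√Real.pi * ‖b‖ / 2) := by
  have hm := (continuous_sliceForm κ a).measurable
  have h4 : ∀ p : H × H, ENNReal.ofReal √(inner ℝ b p.1 ^ 2 + inner ℝ b p.2 ^ 2) =
      ENNReal.ofReal (1 / 4) * ∫⁻ θ in Set.Ioc 0 (2 * Real.pi),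
        ENNReal.ofReal |Real.cos θ * inner ℝ b p.1 + Real.sin θ * inner ℝ b p.2| := by
    intro p
    rw [lintegral_abs_cos_add_sin, ← ENNReal.ofReal_mul (by norm_num)]
    congr 1
    ring
  have e : ∀ p : H × H, ENNReal.ofReal (Real.exp (-(sliceForm κ a p.1 + sliceForm κ a p.2))) *
        ENNReal.ofReal √(inner ℝ b p.1 ^ 2 + inner ℝ b p.2 ^ 2) =
      ENNReal.ofReal (1 / 4) * ∫⁻ θ in Set.Ioc 0 (2 * Real.pi),
        ENNReal.ofReal (Real.exp (-(sliceForm κ a p.1 + sliceForm κ a p.2))) *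
        ENNReal.ofReal |Real.cos θ * inner ℝ b p.1 + Real.sin θ * inner ℝ b p.2| := by
    intro p
    rw [h4, lintegral_const_mul _ (by fun_prop)]
    ring
  rw [lintegral_congr e, lintegral_const_mul _ ?_, lintegral_lintegral_swap (by fun_prop)]
  · simp_rw [lintegral_exp_neg_sliceForm_mul_abs hκ hab, Real.cos_sq_add_sin_sq]
    rw [lintegral_const, Measure.restrict_apply_univ, Real.volume_Ioc, sub_zero, mul_comm, mul_assoc,
      mul_assoc, ← ENNReal.ofReal_mul (by positivity), ← ENNReal.ofReal_mul (by positivity)]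
    congr 2
    rw [one_mul, Real.sqrt_div (by positivity), Real.sqrt_sq (norm_nonneg _)]
    have := Real.sq_sqrt Real.pi_pos.le
    field_simp
    rw [this]
    ring
  · exact Measurable.lintegral_prod_right' (f := fun z : (H × H) × ℝ =>
      ENNReal.ofReal (Real.exp (-(sliceForm κ a z.1.1 + sliceForm κ a z.1.2))) *
        ENNReal.ofReal |Real.cos z.2 * inner ℝ b z.1.1 + Real.sin z.2 * inner ℝ b z.1.2|)
      (by fun_prop)

theorem lintegral_exp_neg_sliceForm_mul_abs_det {κ : ℝ} (hκ : 0 < κ) {a b a' b' : H}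
    (hab : inner ℝ a b = 0) (hab' : inner ℝ a' b' = 0) :
    ∫⁻ p : H × H, ENNReal.ofReal (Real.exp (-(sliceForm κ a p.1 + sliceForm κ a p.2))) *
      ∫⁻ p' : H × H, ENNReal.ofReal (Real.exp (-(sliceForm κ a' p'.1 + sliceForm κ a' p'.2))) *
        ENNReal.ofReal |inner ℝ b p.1 * inner ℝ b' p'.2 - inner ℝ b p.2 * inner ℝ b' p'.1| =
      sliceMass κ a ^ 2 * sliceMass κ a' ^ 2 * ENNReal.ofReal (‖b‖ * ‖b'‖ / 2) := by
  have hm := (continuous_sliceForm κ a).measurable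
  have e : ∀ p : H × H, ∫⁻ p' : H × H,
      ENNReal.ofReal (Real.exp (-(sliceForm κ a' p'.1 + sliceForm κ a' p'.2))) *
        ENNReal.ofReal |inner ℝ b p.1 * inner ℝ b' p'.2 - inner ℝ b p.2 * inner ℝ b' p'.1| =
      sliceMass κ a' ^ 2 * ENNReal.ofReal (‖b'‖ / √Real.pi) *
        ENNReal.ofReal √(inner ℝ b p.1 ^ 2 + inner ℝ b p.2 ^ 2) := by
    intro p
    have h := lintegral_exp_neg_sliceForm_mul_abs hκ hab' (-inner ℝ b p.2) (inner ℝ b p.1)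
    have e2 : ∀ p' : H × H, inner ℝ b p.1 * inner ℝ b' p'.2 - inner ℝ b p.2 * inner ℝ b' p'.1 =
        -inner ℝ b p.2 * inner ℝ b' p'.1 + inner ℝ b p.1 * inner ℝ b' p'.2 := fun p' => by ring
    simp_rw [e2]
    rw [h, mul_assoc, ← ENNReal.ofReal_mul (by positivity)]
    congr 2
    rw [Real.sqrt_div (by positivity), Real.sqrt_mul (by positivity), Real.sqrt_sq (norm_nonneg _),
      neg_sq, add_comm]
    ring
  simp_rw [e]
  have e3 : ∀ p : H × H, ENNReal.ofReal (Real.exp (-(sliceForm κ a p.1 + sliceForm κ a p.2))) *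
      (sliceMass κ a' ^ 2 * ENNReal.ofReal (‖b'‖ / √Real.pi) *
        ENNReal.ofReal √(inner ℝ b p.1 ^ 2 + inner ℝ b p.2 ^ 2)) =
      (sliceMass κ a' ^ 2 * ENNReal.ofReal (‖b'‖ / √Real.pi)) *
      (ENNReal.ofReal (Real.exp (-(sliceForm κ a p.1 + sliceForm κ a p.2))) *
        ENNReal.ofReal √(inner ℝ b p.1 ^ 2 + inner ℝ b p.2 ^ 2)) := fun p => by ring
  rw [lintegral_congr e3, lintegral_const_mul _ (by fun_prop),
    lintegral_exp_neg_sliceForm_mul_sqrt hκ hab]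
  have : ENNReal.ofReal (‖b‖ * ‖b'‖ / 2) =
      ENNReal.ofReal (‖b'‖ / √Real.pi) * ENNReal.ofReal (√Real.pi * ‖b‖ / 2) := by
    rw [← ENNReal.ofReal_mul (by positivity)]
    congr 1
    field_simp
  rw [this]
  ring

end QuadraticForm

theorem det_fst_prod {A T : Type*} [NormedAddCommGroup A] [NormedSpace ℝ A]
    [FiniteDimensional ℝ A] [NormedAddCommGroup T] [NormedSpace ℝ T] [FiniteDimensional ℝ T]
    (G : A × T →L[ℝ] T) :
    ((ContinuousLinearMap.fst ℝ A T).prod G).det =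
      (G.comp (ContinuousLinearMap.inr ℝ A T)).det := by
  classical
  let b := Module.Free.chooseBasis ℝ A
  let b' := Module.Free.chooseBasis ℝ T
  rw [ContinuousLinearMap.det, ContinuousLinearMap.det, ← LinearMap.det_toMatrix (b.prod b'),
    ← LinearMap.det_toMatrix b']
  have : LinearMap.toMatrix (b.prod b') (b.prod b')
      (((ContinuousLinearMap.fst ℝ A T).prod G : A × T →L[ℝ] A × T) : A × T →ₗ[ℝ] A × T) =
      Matrix.fromBlocks 1 0
        (LinearMap.toMatrix b b' ((G.comp (ContinuousLinearMap.inl ℝ A T) : A →L[ℝ] T)))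
        (LinearMap.toMatrix b' b' ((G.comp (ContinuousLinearMap.inr ℝ A T) : T →L[ℝ] T))) := by
    ext (i | i) (j | j) <;>
      simp [LinearMap.toMatrix_apply, Matrix.one_apply, Finsupp.single_apply, eq_comm]
  rw [this, Matrix.det_fromBlocks_zero₁₂, Matrix.det_one, one_mul]

theorem det_real_prod (M : ℝ × ℝ →L[ℝ] ℝ × ℝ) :
    M.det = (M (1, 0)).1 * (M (0, 1)).2 - (M (0, 1)).1 * (M (1, 0)).2 := by
  rw [ContinuousLinearMap.det, ← LinearMap.det_toMatrix (Module.Basis.finTwoProd ℝ),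
    Matrix.det_fin_two]
  simp [LinearMap.toMatrix_apply]

section KacRice

variable {H : Type*} [NormedAddCommGroup H] [InnerProductSpace ℝ H]

/-- The plane curve `φ ↦ c + (⟪h φ, z.1⟫, ⟪h φ, z.2⟫)`. -/
noncomputable def linearCurve (h : ℝ → H) (c : ℝ × ℝ) (z : H × H) (φ : ℝ) : ℝ × ℝ :=
  (c.1 + inner ℝ (h φ) z.1, c.2 + inner ℝ (h φ) z.2)

/-- The squared norm of a curve with constant term `c` and remaining coordinates `z`. -/
noncomputable def curveForm (κ : ℝ) (c : ℝ × ℝ) (z : H × H) : ℝ :=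
  (c.1 ^ 2 + c.2 ^ 2) / κ + (‖z.1‖ ^ 2 + ‖z.2‖ ^ 2)

/-- The Jacobian of the difference of two curves, as a function of their nonconstant parts. -/
noncomputable def crossDet (a b : H) (p p' : H × H) : ℝ :=
  inner ℝ a p.1 * inner ℝ b p'.2 - inner ℝ a p.2 * inner ℝ b p'.1

/-- The space of pairs of curves, with coordinates `((f, z), c)`, where `f` is the first curve, and
`z` and `c` are the nonconstant and the constant part of the second. -/
abbrev CurvePair (H : Type*) : Type _ := (((ℝ × ℝ) × (H × H)) × (H × H)) × (ℝ × ℝ)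

/-- The parameters at which the two curves meet. -/
def crossings (h : ℝ → H) (ω : CurvePair H) : Set (ℝ × ℝ) :=
  {t | t ∈ Set.Ico 0 (2 * Real.pi) ×ˢ Set.Ico 0 (2 * Real.pi) ∧
    linearCurve h ω.1.1.1 ω.1.1.2 t.1 = linearCurve h ω.2 ω.1.2 t.2}

variable [FiniteDimensional ℝ H] [MeasurableSpace H] [BorelSpace H] {h h' : ℝ → H}

instance isAddHaarMeasure_volume_prod_self : (volume : Measure (H × H)).IsAddHaarMeasure :=
  Measure.prod.instIsAddHaarMeasure _ _

instance isAddHaarMeasure_volume_curve :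
    (volume : Measure ((ℝ × ℝ) × (H × H))).IsAddHaarMeasure :=
  Measure.prod.instIsAddHaarMeasure (volume : Measure (ℝ × ℝ)) (volume : Measure (H × H))

instance isAddHaarMeasure_volume_curvePair : (volume : Measure (CurvePair H)).IsAddHaarMeasure :=
  have : (volume : Measure (((ℝ × ℝ) × (H × H)) × (H × H))).IsAddHaarMeasure :=
    Measure.prod.instIsAddHaarMeasure (volume : Measure ((ℝ × ℝ) × (H × H)))
      (volume : Measure (H × H))
  Measure.prod.instIsAddHaarMeasure (volume : Measure (((ℝ × ℝ) × (H × H)) × (H × H)))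
    (volume : Measure (ℝ × ℝ))

theorem exists_measurable_encard_crossings (hh : ∀ φ, HasDerivAt h (h' φ) φ)
    (hc : Continuous h') :
    ∃ n : CurvePair H → ℝ≥0∞, Measurable n ∧
      (∀ᵐ ω, n ω = ((crossings h ω).encard : ℝ≥0∞)) ∧
      ∀ g : CurvePair H → ℝ≥0∞, Measurable g →
        ∫⁻ ω, g ω * n ω =
          ∫⁻ t in Set.Ico 0 (2 * Real.pi) ×ˢ Set.Ico 0 (2 * Real.pi),
            ∫⁻ a : ((ℝ × ℝ) × (H × H)) × (H × H),
              ENNReal.ofReal |crossDet (h' t.1) (h' t.2) a.1.2 a.2| *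
                g (a, linearCurve h a.1.1 a.1.2 t.1 - linearCurve h 0 a.2 t.2) := by
  have hh1 : ContDiff ℝ 1 h := by
    rw [contDiff_one_iff_deriv]
    refine ⟨fun φ => (hh φ).differentiableAt, ?_⟩
    rwa [show deriv h = h' from funext fun φ => (hh φ).deriv]
  set S : Set (ℝ × ℝ) := Set.Ico 0 (2 * Real.pi) ×ˢ Set.Ico 0 (2 * Real.pi) with hS
  have mS : MeasurableSet S := measurableSet_Ico.prod measurableSet_Ico
  let G : CurvePair H → ℝ × ℝ := fun x =>
    linearCurve h x.1.1.1 x.1.1.2 x.2.1 - linearCurve h 0 x.1.2 x.2.2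
  have hG : ContDiff ℝ 1 G := by
    have h1 : ContDiff ℝ 1 fun x : CurvePair H => h x.2.1 := hh1.comp (by fun_prop)
    have h2 : ContDiff ℝ 1 fun x : CurvePair H => h x.2.2 := hh1.comp (by fun_prop)
    unfold G linearCurve
    refine ContDiff.sub (ContDiff.prodMk (.add (by fun_prop) (h1.inner ℝ (by fun_prop)))
      (.add (by fun_prop) (h1.inner ℝ (by fun_prop)))) (ContDiff.prodMk
      (.add (by fun_prop) (h2.inner ℝ (by fun_prop)))
      (.add (by fun_prop) (h2.inner ℝ (by fun_prop))))
  have hGd : ∀ x, HasFDerivAt G (fderiv ℝ G x) x := fun x =>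
    (hG.differentiable one_ne_zero x).hasFDerivAt
  have hdet : ∀ x : CurvePair H,
      |((ContinuousLinearMap.fst ℝ _ _).prod (fderiv ℝ G x)).det| =
        |crossDet (h' x.2.1) (h' x.2.2) x.1.1.2 x.1.2| := by
    intro x
    have h1 : HasFDerivAt (fun t : ℝ × ℝ => G (x.1, t))
        ((fderiv ℝ G x).comp (ContinuousLinearMap.inr ℝ _ _)) x.2 :=
      HasFDerivAt.comp (g := G) x.2 (hGd x) (hasFDerivAt_prodMk_right x.1 x.2)
    have hin : ∀ (φ : ℝ) (z : H), HasDerivAt (fun s => inner ℝ (h s) z) (inner ℝ (h' φ) z) φ := by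
      intro φ z
      simpa using (hh φ).inner ℝ (hasDerivAt_const φ z)
    have e1 : ((fderiv ℝ G x).comp (ContinuousLinearMap.inr ℝ _ _)) (1, 0) =
        (inner ℝ (h' x.2.1) x.1.1.2.1, inner ℝ (h' x.2.1) x.1.1.2.2) := by
      have hl : HasDerivAt (fun s : ℝ => (s, x.2.2)) ((1 : ℝ), (0 : ℝ)) x.2.1 :=
        (hasDerivAt_id _).prodMk (hasDerivAt_const _ _)
      have h2 := HasFDerivAt.comp_hasDerivAt x.2.1 (f := fun s : ℝ => (s, x.2.2)) h1 hl
      refine h2.unique ?_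
      simp only [G, linearCurve, Function.comp_def, Prod.mk_sub_mk]
      exact (((hin x.2.1 x.1.1.2.1).const_add _).sub_const _).prodMk
        (((hin x.2.1 x.1.1.2.2).const_add _).sub_const _)
    have e2 : ((fderiv ℝ G x).comp (ContinuousLinearMap.inr ℝ _ _)) (0, 1) =
        (-inner ℝ (h' x.2.2) x.1.2.1, -inner ℝ (h' x.2.2) x.1.2.2) := by
      have hl : HasDerivAt (fun s : ℝ => (x.2.1, s)) ((0 : ℝ), (1 : ℝ)) x.2.2 :=
        (hasDerivAt_const _ _).prodMk (hasDerivAt_id _)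
      have h2 := HasFDerivAt.comp_hasDerivAt x.2.2 (f := fun s : ℝ => (x.2.1, s)) h1 hl
      refine h2.unique ?_
      simp only [G, linearCurve, Function.comp_def, Prod.mk_sub_mk]
      exact (((hin x.2.2 x.1.2.1).const_add _).const_sub _).prodMk
        (((hin x.2.2 x.1.2.2).const_add _).const_sub _)
    rw [det_fst_prod, det_real_prod, e1, e2, ← abs_neg, crossDet]
    congr 1
    ring
  obtain ⟨n, mn, hn, hint⟩ := exists_measurable_encard_fiber (volume : Measure (CurvePair H))
    (f := fun x => (x.1, G x)) (f' := fun x => (ContinuousLinearMap.fst ℝ _ _).prod (fderiv ℝ G x))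
    (s := Set.univ ×ˢ S) (fun x => hasFDerivAt_fst.prodMk (hGd x))
    (by
      have h1 := (contDiff_fst.prodMk hG).continuous_fderiv one_ne_zero
      have h2 : ∀ x, fderiv ℝ (fun x : CurvePair H => (x.1, G x)) x =
          (ContinuousLinearMap.fst ℝ _ _).prod (fderiv ℝ G x) := fun x =>
        (hasFDerivAt_fst.prodMk (hGd x)).fderiv
      have h3 := funext h2
      rwa [h3] at h1)
    (MeasurableSet.univ.prod mS)
  refine ⟨n, mn, ?_, ?_⟩
  · filter_upwards [hn] with ω hω
    rw [hω]
    congr 1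
    have : (Set.univ ×ˢ S ∩ (fun x : CurvePair H => (x.1, G x)) ⁻¹' {ω} : Set (CurvePair H)) =
        (fun t => (ω.1, t)) '' crossings h ω := by
      ext x
      obtain ⟨⟨f, z⟩, t⟩ := x
      obtain ⟨⟨f', z'⟩, c⟩ := ω
      have hiff : ∀ p q : ℝ × ℝ, p - linearCurve h 0 z t.2 = q ↔ p = linearCurve h q z t.2 := by
        intro p q
        simp only [linearCurve, sub_eq_iff_eq_add, Prod.ext_iff, Prod.fst_add, Prod.snd_add,
          Prod.fst_zero, Prod.snd_zero, zero_add]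
      simp only [Set.mem_inter_iff, Set.mem_prod, Set.mem_univ, true_and, Set.mem_preimage,
        Set.mem_singleton_iff, Set.mem_image, crossings, Set.mem_ofPred_eq, Prod.mk.injEq, G,
        hiff, hS]
      constructor
      · rintro ⟨h1, ⟨rfl, rfl⟩, h2⟩
        exact ⟨t, ⟨h1, h2⟩, ⟨rfl, rfl⟩, rfl⟩
      · rintro ⟨s, ⟨h1, h2⟩, ⟨rfl, rfl⟩, rfl⟩
        exact ⟨h1, ⟨rfl, rfl⟩, h2⟩
    rw [this, Function.Injective.encard_image]
    exact fun s t hst => (Prod.mk.inj hst).2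
  · intro g hg
    rw [hint g hg]
    have hcG : Continuous G := hG.continuous
    have hch : Continuous h := hh1.continuous
    rw [Measure.volume_eq_prod, ← Measure.prod_restrict, Measure.restrict_univ,
      lintegral_prod_symm]
    · refine lintegral_congr fun t => lintegral_congr fun a => ?_
      rw [hdet]
    · simp_rw [hdet]
      refine Measurable.aemeasurable ?_
      refine Measurable.mul ?_ (hg.comp (by fun_prop))
      refine Measurable.ennreal_ofReal (Continuous.measurable ?_)
      unfold crossDet
      fun_prop

end KacRice

section KacRice

variable {H : Type*} [NormedAddCommGroup H] [InnerProductSpace ℝ H] [FiniteDimensional ℝ H]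
  [MeasurableSpace H] [BorelSpace H]

theorem measurable_crossDet {α : Type*} [MeasurableSpace α] (a b : H) {f g : α → H × H}
    (hf : Measurable f) (hg : Measurable g) : Measurable fun x => crossDet a b (f x) (g x) := by
  unfold crossDet
  fun_prop

omit [InnerProductSpace ℝ H] [FiniteDimensional ℝ H] in
theorem measurable_curveForm {α : Type*} [MeasurableSpace α] (κ : ℝ) {f : α → ℝ × ℝ}
    {g : α → H × H} (hf : Measurable f) (hg : Measurable g) :
    Measurable fun x => curveForm κ (f x) (g x) := by
  unfold curveForm
  fun_prop

/-- The pair of scalar products with a fixed vector. -/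
noncomputable def innerPair (a : H) (z : H × H) : ℝ × ℝ := (inner ℝ a z.1, inner ℝ a z.2)

omit [FiniteDimensional ℝ H] [MeasurableSpace H] [BorelSpace H] in
theorem continuous_innerPair (a : H) : Continuous (innerPair a) := by
  unfold innerPair
  fun_prop

theorem lintegral_abs_crossDet_slice {κ P : ℝ} (hκ : 0 < κ) {a a' b b' : H}
    (ha : κ + ‖a‖ ^ 2 = P) (ha' : κ + ‖a'‖ ^ 2 = P) (hab : inner ℝ b a = 0)
    (hab' : inner ℝ b' a' = 0) {χ : ℝ → ℝ≥0∞} (hχ : Measurable χ) :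
    ∫⁻ x : ((ℝ × ℝ) × (H × H)) × (H × H), ENNReal.ofReal |crossDet b b' x.1.2 x.2| *
        (χ (curveForm κ x.1.1 x.1.2) *
          χ (curveForm κ (x.1.1 + innerPair a x.1.2 - innerPair a' x.2) x.2)) =
      ∫⁻ w : ℝ × ℝ, ∫⁻ z' : H × H, ∫⁻ z : H × H, ENNReal.ofReal |crossDet b b' z z'| *
        (χ ((w.1 ^ 2 + w.2 ^ 2) / P + (sliceForm κ a z.1 + sliceForm κ a z.2)) *
          χ ((w.1 ^ 2 + w.2 ^ 2) / P + (sliceForm κ a' z'.1 + sliceForm κ a' z'.2))) := by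
  have mp : Measurable (innerPair a) := (continuous_innerPair a).measurable
  have mp' : Measurable (innerPair a') := (continuous_innerPair a').measurable
  have mF : Measurable fun x : (ℝ × ℝ) × (H × H) × (H × H) =>
      ENNReal.ofReal |crossDet b b' x.2.1 x.2.2| *
        (χ (curveForm κ (x.1 - innerPair a x.2.1) x.2.1) *
          χ (curveForm κ (x.1 - innerPair a' x.2.2) x.2.2)) := by
    have h1 := measurable_crossDet b b' (f := fun x : (ℝ × ℝ) × (H × H) × (H × H) => x.2.1)
      (g := fun x => x.2.2) (by fun_prop) (by fun_prop)
    have h2 := measurable_curveForm κ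
      (f := fun x : (ℝ × ℝ) × (H × H) × (H × H) => x.1 - innerPair a x.2.1)
      (g := fun x => x.2.1) (by fun_prop) (by fun_prop)
    have h3 := measurable_curveForm κ
      (f := fun x : (ℝ × ℝ) × (H × H) × (H × H) => x.1 - innerPair a' x.2.2)
      (g := fun x => x.2.2) (by fun_prop) (by fun_prop)
    fun_prop
  have mL : Measurable fun x : ((ℝ × ℝ) × (H × H)) × (H × H) =>
      ENNReal.ofReal |crossDet b b' x.1.2 x.2| *
        (χ (curveForm κ x.1.1 x.1.2) *
          χ (curveForm κ (x.1.1 + innerPair a x.1.2 - innerPair a' x.2) x.2)) := by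
    have := mF.comp (f := fun x : ((ℝ × ℝ) × (H × H)) × (H × H) =>
      (x.1.1 + innerPair a x.1.2, x.1.2, x.2)) (by fun_prop)
    simpa only [Function.comp_def, add_sub_cancel_right] using this
  rw [Measure.volume_eq_prod, lintegral_prod_symm _ mL.aemeasurable]
  have e1 : ∀ z' : H × H, ∫⁻ y : (ℝ × ℝ) × (H × H), ENNReal.ofReal |crossDet b b' y.2 z'| *
        (χ (curveForm κ y.1 y.2) *
          χ (curveForm κ (y.1 + innerPair a y.2 - innerPair a' z') z')) =
      ∫⁻ w : ℝ × ℝ, ∫⁻ z : H × H, ENNReal.ofReal |crossDet b b' z z'| *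
        (χ (curveForm κ (w - innerPair a z) z) * χ (curveForm κ (w - innerPair a' z') z')) := by
    intro z'
    rw [Measure.volume_eq_prod, lintegral_prod_symm _
      (by exact (mL.comp (f := fun y => (y, z')) (by fun_prop)).aemeasurable)]
    refine Eq.trans (lintegral_congr fun z => ?_) (lintegral_lintegral_swap
      (f := fun (z : H × H) (w : ℝ × ℝ) => ENNReal.ofReal |crossDet b b' z z'| *
        (χ (curveForm κ (w - innerPair a z) z) * χ (curveForm κ (w - innerPair a' z') z')))
      (by exact (mF.comp (f := fun y : (H × H) × (ℝ × ℝ) => (y.2, y.1, z'))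
        (by fun_prop)).aemeasurable))
    rw [← lintegral_sub_right_eq_self
      (fun c : ℝ × ℝ => ENNReal.ofReal |crossDet b b' z z'| * (χ (curveForm κ c z) *
          χ (curveForm κ (c + innerPair a z - innerPair a' z') z'))) (innerPair a z)]
    simp only [sub_add_cancel]
  rw [lintegral_congr e1, lintegral_lintegral_swap]
  · refine lintegral_congr fun w => ?_
    rw [← lintegral_add_right_eq_self _ (((w.1 / P) • a', (w.2 / P) • a') : H × H)]
    refine lintegral_congr fun z' => ?_
    rw [← lintegral_add_right_eq_self _ (((w.1 / P) • a, (w.2 / P) • a) : H × H)]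
    refine lintegral_congr fun z => ?_
    have hform : ∀ {a : H}, κ + ‖a‖ ^ 2 = P → ∀ z : H × H,
        curveForm κ (w - innerPair a (z + ((w.1 / P) • a, (w.2 / P) • a)))
          (z + ((w.1 / P) • a, (w.2 / P) • a)) =
        (w.1 ^ 2 + w.2 ^ 2) / P + (sliceForm κ a z.1 + sliceForm κ a z.2) := by
      intro a ha z
      have h1 := sq_sub_inner_div_add_norm_sq hκ ha w.1 z.1
      have h2 := sq_sub_inner_div_add_norm_sq hκ ha w.2 z.2
      simp only [curveForm, innerPair, Prod.fst_add, Prod.snd_add, Prod.fst_sub, Prod.snd_sub]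
      rw [add_div, add_div]
      linear_combination h1 + h2
    rw [hform ha, hform ha']
    congr 3
    simp only [crossDet, Prod.fst_add, Prod.snd_add, inner_add_right, inner_smul_right, hab, hab',
      mul_zero, add_zero]
  · have := Measurable.lintegral_prod_right' (ν := (volume : Measure (H × H)))
      (mF.comp (f := fun x : ((H × H) × (ℝ × ℝ)) × (H × H) => (x.1.2, x.2, x.1.1))
        (by fun_prop))
    exact this.aemeasurable

/-- The integral of `|crossDet|` over the product of the unit balls of the two slice forms. -/
noncomputable def crossMass (κ : ℝ) (a a' b b' : H) : ℝ≥0∞ :=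
  ∫⁻ z' in {z' : H × H | sliceForm κ a' z'.1 + sliceForm κ a' z'.2 ≤ 1},
    ∫⁻ z in {z : H × H | sliceForm κ a z.1 + sliceForm κ a z.2 ≤ 1},
      ENNReal.ofReal |crossDet b b' z z'|

omit [FiniteDimensional ℝ H] [MeasurableSpace H] [BorelSpace H] in
theorem sliceForm_prod_smul (κ : ℝ) (a : H) (c : ℝ) (z : H × H) :
    sliceForm κ a (c • z).1 + sliceForm κ a (c • z).2 =
      c ^ 2 * (sliceForm κ a z.1 + sliceForm κ a z.2) := by
  rw [Prod.smul_fst, Prod.smul_snd, sliceForm_smul, sliceForm_smul]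
  ring

omit [FiniteDimensional ℝ H] [MeasurableSpace H] [BorelSpace H] in
theorem ofReal_abs_crossDet_smul_left (b b' : H) {c : ℝ} (hc : 0 < c) (z z' : H × H) :
    ENNReal.ofReal |crossDet b b' (c • z) z'| =
      ENNReal.ofReal (c ^ 1) * ENNReal.ofReal |crossDet b b' z z'| := by
  rw [← ENNReal.ofReal_mul (by positivity), pow_one, ← abs_of_pos hc, ← abs_mul, abs_of_pos hc]
  congr 2
  simp only [crossDet, Prod.smul_fst, Prod.smul_snd, inner_smul_right]
  ring

omit [FiniteDimensional ℝ H] [MeasurableSpace H] [BorelSpace H] in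
theorem ofReal_abs_crossDet_smul_right (b b' : H) {c : ℝ} (hc : 0 < c) (z z' : H × H) :
    ENNReal.ofReal |crossDet b b' z (c • z')| =
      ENNReal.ofReal (c ^ 1) * ENNReal.ofReal |crossDet b b' z z'| := by
  rw [← ENNReal.ofReal_mul (by positivity), pow_one, ← abs_of_pos hc, ← abs_mul, abs_of_pos hc]
  congr 2
  simp only [crossDet, Prod.smul_fst, Prod.smul_snd, inner_smul_right]
  ring

omit [FiniteDimensional ℝ H] in
theorem measurable_sliceForm_prod (κ : ℝ) (a : H) :
    Measurable fun z : H × H => sliceForm κ a z.1 + sliceForm κ a z.2 := by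
  have := (continuous_sliceForm κ a).measurable
  fun_prop

theorem measurable_setLIntegral_crossDet (b b' : H) (s : Set (H × H)) :
    Measurable fun z' : H × H => ∫⁻ z in s, ENNReal.ofReal |crossDet b b' z z'| := by
  refine Measurable.lintegral_prod_right'
    (f := fun x : (H × H) × (H × H) => ENNReal.ofReal |crossDet b b' x.2 x.1|) ?_
  have := measurable_crossDet b b' (f := fun x : (H × H) × (H × H) => x.2)
      (g := fun x => x.1) (by fun_prop) (by fun_prop)
  fun_prop

theorem ofReal_smul_setLIntegral_crossDet (b b' : H) (s : Set (H × H)) {c : ℝ} (hc : 0 < c)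
    (z' : H × H) :
    ∫⁻ z in s, ENNReal.ofReal |crossDet b b' z (c • z')| =
      ENNReal.ofReal (c ^ 1) * ∫⁻ z in s, ENNReal.ofReal |crossDet b b' z z'| := by
  rw [← lintegral_const_mul' _ _ ENNReal.ofReal_ne_top]
  exact lintegral_congr fun z => ofReal_abs_crossDet_smul_right b b' hc z z'

theorem gamma_sq_mul_crossMass {κ : ℝ} (hκ : 0 < κ) {a a' b b' : H}
    (hab : inner ℝ a b = 0) (hab' : inner ℝ a' b' = 0) :
    ENNReal.ofReal (Real.Gamma ((Module.finrank ℝ H : ℝ) + 3 / 2)) ^ 2 *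
        crossMass κ a a' b b' =
      sliceMass κ a ^ 2 * sliceMass κ a' ^ 2 * ENNReal.ofReal (‖b‖ * ‖b'‖ / 2) := by
  have hfin : ((Module.finrank ℝ (H × H) + 1 : ℕ) : ℝ) / 2 + 1 =
      (Module.finrank ℝ H : ℝ) + 3 / 2 := by
    rw [Module.finrank_prod]
    push_cast
    ring
  have mD : ∀ z' : H × H, Measurable fun z => ENNReal.ofReal |crossDet b b' z z'| := by
    intro z'
    have := measurable_crossDet b b' (f := fun z : H × H => z) (g := fun _ => z')
      (by fun_prop) (by fun_prop)
    fun_prop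
  have h1 : ∀ z' : H × H, ∫⁻ z : H × H,
      ENNReal.ofReal (Real.exp (-(sliceForm κ a z.1 + sliceForm κ a z.2))) *
        ENNReal.ofReal |crossDet b b' z z'| =
      ENNReal.ofReal (Real.Gamma ((Module.finrank ℝ H : ℝ) + 3 / 2)) *
        ∫⁻ z in {z : H × H | sliceForm κ a z.1 + sliceForm κ a z.2 ≤ 1},
          ENNReal.ofReal |crossDet b b' z z'| := by
    intro z'
    rw [← hfin]
    exact lintegral_exp_neg_of_homogeneous volume (measurable_sliceForm_prod κ a) (mD z')
      (fun z => add_nonneg (sliceForm_nonneg hκ a _) (sliceForm_nonneg hκ a _))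
      (fun c _ z => sliceForm_prod_smul κ a c z)
      (fun c hc z => ofReal_abs_crossDet_smul_left b b' hc z z')
  have h2 := lintegral_exp_neg_of_homogeneous (d := 1) (volume : Measure (H × H))
    (measurable_sliceForm_prod κ a')
    (measurable_setLIntegral_crossDet b b' {z | sliceForm κ a z.1 + sliceForm κ a z.2 ≤ 1})
    (fun z => add_nonneg (sliceForm_nonneg hκ a' _) (sliceForm_nonneg hκ a' _))
    (fun c _ z => sliceForm_prod_smul κ a' c z)
    (fun c hc z' => ofReal_smul_setLIntegral_crossDet b b' _ hc z')
  have hmain := lintegral_exp_neg_sliceForm_mul_abs_det hκ (a := a') (b := b') (a' := a) (b' := b)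
    hab' hab
  have e3 : ∀ z' z : H × H, inner ℝ b' z'.1 * inner ℝ b z.2 - inner ℝ b' z'.2 * inner ℝ b z.1 =
      -crossDet b b' z z' := fun z' z => by rw [crossDet]; ring
  simp_rw [e3, abs_neg, h1] at hmain
  rw [mul_comm (sliceMass κ a ^ 2), mul_comm ‖b‖, ← hmain, crossMass, sq, mul_assoc]
  rw [hfin] at h2
  rw [← h2, ← lintegral_const_mul' _ _ ENNReal.ofReal_ne_top]
  refine lintegral_congr fun z' => ?_
  ring

theorem lintegral_abs_crossDet_sublevel {κ : ℝ} (hκ : 0 < κ) (a a' b b' : H) (R : ℝ) :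
    ∫⁻ z' in {z' : H × H | sliceForm κ a' z'.1 + sliceForm κ a' z'.2 ≤ R},
      ∫⁻ z in {z : H × H | sliceForm κ a z.1 + sliceForm κ a z.2 ≤ R},
        ENNReal.ofReal |crossDet b b' z z'| =
      ENNReal.ofReal (max 0 R ^ (2 * Module.finrank ℝ H + 1)) * crossMass κ a a' b b' := by
  have hm : MeasurableSet {z' : H × H | sliceForm κ a' z'.1 + sliceForm κ a' z'.2 ≤ R} :=
    measurableSet_le (measurable_sliceForm_prod κ a') measurable_const
  rcases lt_or_ge 0 R with hR | hR
  · have mD : ∀ z' : H × H, Measurable fun z => ENNReal.ofReal |crossDet b b' z z'| := by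
      intro z'
      have := measurable_crossDet b b' (f := fun z : H × H => z) (g := fun _ => z')
        (by fun_prop) (by fun_prop)
      fun_prop
    have h1 : ∀ z' : H × H,
        ∫⁻ z in {z : H × H | sliceForm κ a z.1 + sliceForm κ a z.2 ≤ R},
          ENNReal.ofReal |crossDet b b' z z'| =
        ENNReal.ofReal (R ^ (((Module.finrank ℝ (H × H) + 1 : ℕ) : ℝ) / 2)) *
          ∫⁻ z in {z : H × H | sliceForm κ a z.1 + sliceForm κ a z.2 ≤ 1},
            ENNReal.ofReal |crossDet b b' z z'| := fun z' =>
      lintegral_sublevel_of_homogeneous volume (measurable_sliceForm_prod κ a) (mD z')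
        (fun c _ z => sliceForm_prod_smul κ a c z)
        (fun c hc z => ofReal_abs_crossDet_smul_left b b' hc z z') hR
    simp_rw [h1]
    rw [lintegral_const_mul' _ _ ENNReal.ofReal_ne_top,
      lintegral_sublevel_of_homogeneous (d := 1) (volume : Measure (H × H))
        (measurable_sliceForm_prod κ a')
        (measurable_setLIntegral_crossDet b b' _)
        (fun c _ z => sliceForm_prod_smul κ a' c z)
        (fun c hc z' => ofReal_smul_setLIntegral_crossDet b b' _ hc z') hR, ← mul_assoc,
      ← ENNReal.ofReal_mul (by positivity), crossMass, max_eq_right hR.le, ← Real.rpow_add hR,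
      ← Real.rpow_natCast]
    congr 3
    rw [Module.finrank_prod]
    push_cast
    ring
  · rw [max_eq_left hR, zero_pow (by positivity), ENNReal.ofReal_zero, zero_mul,
      setLIntegral_congr_fun (g := fun _ => 0) hm]
    · simp
    · intro z' hz'
      have h0 : ∀ x : H, 0 ≤ sliceForm κ a' x := sliceForm_nonneg hκ a'
      have hz1 : z'.1 = 0 := eq_zero_of_sliceForm_nonpos hκ (a := a')
        (by linarith [h0 z'.2, hz'.out])
      have hz2 : z'.2 = 0 := eq_zero_of_sliceForm_nonpos hκ (a := a')
        (by linarith [h0 z'.1, hz'.out])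
      simp [crossDet, hz1, hz2]

/-- The product of the unit balls of `curveForm` in the space of pairs of curves. -/
def curvePairBall (κ : ℝ) (H : Type*) [NormedAddCommGroup H] : Set (CurvePair H) :=
  {ω | curveForm κ ω.1.1.1 ω.1.1.2 ≤ 1 ∧ curveForm κ ω.2 ω.1.2 ≤ 1}

end KacRice

section KacRice

variable {H : Type*} [NormedAddCommGroup H] [InnerProductSpace ℝ H] [FiniteDimensional ℝ H]
  [MeasurableSpace H] [BorelSpace H]

theorem sliceMass_sq {κ P : ℝ} (hκ : 0 < κ) {a : H} (hP : κ + ‖a‖ ^ 2 = P) :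
    sliceMass κ a ^ 2 = ENNReal.ofReal (κ / P * Real.pi ^ Module.finrank ℝ H) := by
  have hP0 : 0 < P := by
    rw [← hP]; positivity
  have h := congrArg (· ^ 2) (sliceMass_mul hκ hP)
  simp only [mul_pow] at h
  rw [← ENNReal.ofReal_pow (by positivity), ← ENNReal.ofReal_pow (by positivity),
    ← ENNReal.ofReal_pow (by positivity), Real.sq_sqrt (by positivity),
    Real.sq_sqrt (by positivity), ← Real.rpow_natCast, ← Real.rpow_mul Real.pi_pos.le] at h
  have h2 : ((Module.finrank ℝ H : ℝ) / 2) * (2 : ℕ) = Module.finrank ℝ H := by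
    push_cast
    ring
  rw [h2, Real.rpow_natCast] at h
  have h3 : ENNReal.ofReal (Real.pi * P) ≠ 0 := by
    simpa using by positivity
  rw [← ENNReal.mul_right_inj h3 ENNReal.ofReal_ne_top, h, ← ENNReal.ofReal_mul (by positivity),
    ← ENNReal.ofReal_mul (by positivity)]
  congr 1
  field_simp

theorem crossMass_eq {κ P q : ℝ} (hκ : 0 < κ) {a a' b b' : H} (ha : κ + ‖a‖ ^ 2 = P)
    (ha' : κ + ‖a'‖ ^ 2 = P) (hab : inner ℝ a b = 0) (hab' : inner ℝ a' b' = 0)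
    (hb : ‖b‖ = q) (hb' : ‖b'‖ = q) :
    crossMass κ a a' b b' = ENNReal.ofReal
      ((κ / P * Real.pi ^ Module.finrank ℝ H) ^ 2 * (q ^ 2 / 2) /
        Real.Gamma (Module.finrank ℝ H + 3 / 2) ^ 2) := by
  have hP0 : 0 < P := by
    rw [← ha]; positivity
  have hΓ : 0 < Real.Gamma ((Module.finrank ℝ H : ℝ) + 3 / 2) :=
    Real.Gamma_pos_of_pos (by positivity)
  have h := gamma_sq_mul_crossMass hκ hab hab'
  rw [sliceMass_sq hκ ha, sliceMass_sq hκ ha', hb, hb', ← ENNReal.ofReal_pow hΓ.le,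
    ← ENNReal.ofReal_mul (by positivity), ← ENNReal.ofReal_mul (by positivity)] at h
  have h3 : ENNReal.ofReal (Real.Gamma ((Module.finrank ℝ H : ℝ) + 3 / 2) ^ 2) ≠ 0 := by
    simpa using by positivity
  rw [← ENNReal.mul_right_inj h3 ENNReal.ofReal_ne_top, h, ← ENNReal.ofReal_mul (by positivity)]
  congr 1
  field_simp

theorem volume_curveForm_le_one {κ : ℝ} (hκ : 0 < κ) :
    volume {f : (ℝ × ℝ) × (H × H) | curveForm κ f.1 f.2 ≤ 1} =
      ENNReal.ofReal (κ * Real.pi ^ (Module.finrank ℝ H + 1) /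
        Real.Gamma (Module.finrank ℝ H + 2)) := by
  have hΓ : 0 < Real.Gamma ((Module.finrank ℝ H : ℝ) + 2) :=
    Real.Gamma_pos_of_pos (by positivity)
  have hq := measurable_curveForm κ (f := fun f : (ℝ × ℝ) × (H × H) => f.1) (g := fun f => f.2)
    (by fun_prop) (by fun_prop)
  have h := lintegral_exp_neg_of_homogeneous (d := 0) (f := fun _ => 1)
    (volume : Measure ((ℝ × ℝ) × (H × H))) hq measurable_const
    (fun f => by unfold curveForm; positivity)
    (fun c _ f => by
      simp only [curveForm, Prod.smul_fst, Prod.smul_snd, norm_smul, smul_eq_mul, mul_pow,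
        Real.norm_eq_abs, sq_abs]
      ring) (fun c _ f => by simp)
  have hfin : ((Module.finrank ℝ ((ℝ × ℝ) × (H × H)) + 0 : ℕ) : ℝ) / 2 + 1 =
      (Module.finrank ℝ H : ℝ) + 2 := by
    rw [Module.finrank_prod, Module.finrank_prod, Module.finrank_prod, Module.finrank_self]
    push_cast
    ring
  rw [hfin] at h
  simp only [mul_one, lintegral_one, Measure.restrict_apply_univ] at h
  have e : ∀ f : (ℝ × ℝ) × (H × H), ENNReal.ofReal (Real.exp (-curveForm κ f.1 f.2)) =
      (ENNReal.ofReal (Real.exp (-(f.1.1 ^ 2 / κ))) * ENNReal.ofReal (Real.exp (-(f.1.2 ^ 2 / κ))))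
      * (ENNReal.ofReal (Real.exp (-‖f.2.1‖ ^ 2)) * ENNReal.ofReal (Real.exp (-‖f.2.2‖ ^ 2))) := by
    intro f
    rw [← ENNReal.ofReal_mul (Real.exp_pos _).le, ← ENNReal.ofReal_mul (Real.exp_pos _).le,
      ← ENNReal.ofReal_mul (by positivity), ← Real.exp_add, ← Real.exp_add, ← Real.exp_add]
    congr 2
    unfold curveForm
    ring
  rw [lintegral_congr e, Measure.volume_eq_prod, lintegral_prod_mul
    (f := fun c : ℝ × ℝ => ENNReal.ofReal (Real.exp (-(c.1 ^ 2 / κ))) *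
      ENNReal.ofReal (Real.exp (-(c.2 ^ 2 / κ))))
    (g := fun z : H × H => ENNReal.ofReal (Real.exp (-‖z.1‖ ^ 2)) *
      ENNReal.ofReal (Real.exp (-‖z.2‖ ^ 2))) (by fun_prop) (by fun_prop),
    Measure.volume_eq_prod, Measure.volume_eq_prod,
    lintegral_prod_mul (f := fun c : ℝ => ENNReal.ofReal (Real.exp (-(c ^ 2 / κ))))
      (g := fun c : ℝ => ENNReal.ofReal (Real.exp (-(c ^ 2 / κ)))) (by fun_prop) (by fun_prop),
    lintegral_prod_mul (f := fun z : H => ENNReal.ofReal (Real.exp (-‖z‖ ^ 2)))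
      (g := fun z : H => ENNReal.ofReal (Real.exp (-‖z‖ ^ 2))) (by fun_prop) (by fun_prop),
    lintegral_exp_neg_sq_div hκ, lintegral_exp_neg_norm_sq, ← ENNReal.ofReal_mul (by positivity),
    ← ENNReal.ofReal_mul (by positivity), ← ENNReal.ofReal_mul (by positivity),
    Real.mul_self_sqrt (by positivity), ← Real.rpow_add Real.pi_pos, add_halves,
    Real.rpow_natCast] at h
  have h3 : ENNReal.ofReal (Real.Gamma ((Module.finrank ℝ H : ℝ) + 2)) ≠ 0 := by
    simpa using by positivity
  rw [← ENNReal.mul_right_inj h3 ENNReal.ofReal_ne_top, Measure.volume_eq_prod,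
    Measure.volume_eq_prod, Measure.volume_eq_prod, ← h, ← ENNReal.ofReal_mul (by positivity)]
  congr 1
  field_simp
  ring

omit [InnerProductSpace ℝ H] [FiniteDimensional ℝ H] in
theorem measurableSet_curvePairBall (κ : ℝ) : MeasurableSet (curvePairBall κ H) := by
  have h1 := measurable_curveForm κ (f := fun ω : CurvePair H => ω.1.1.1) (g := fun ω => ω.1.1.2)
    (by fun_prop) (by fun_prop)
  have h2 := measurable_curveForm κ (f := fun ω : CurvePair H => ω.2) (g := fun ω => ω.1.2)
    (by fun_prop) (by fun_prop)
  exact (measurableSet_le h1 measurable_const).inter (measurableSet_le h2 measurable_const)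

theorem volume_curvePairBall {κ : ℝ} (hκ : 0 < κ) :
    volume (curvePairBall κ H) =
      ENNReal.ofReal ((κ * Real.pi ^ (Module.finrank ℝ H + 1) /
        Real.Gamma (Module.finrank ℝ H + 2)) ^ 2) := by
  have hΓ : 0 < Real.Gamma ((Module.finrank ℝ H : ℝ) + 2) :=
    Real.Gamma_pos_of_pos (by positivity)
  have hB : MeasurableSet {f : (ℝ × ℝ) × (H × H) | curveForm κ f.1 f.2 ≤ 1} :=
    measurableSet_le (measurable_curveForm κ (f := fun f : (ℝ × ℝ) × (H × H) => f.1)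
      (g := fun f => f.2) (by fun_prop) (by fun_prop)) measurable_const
  have hB' : MeasurableSet {f : (H × H) × (ℝ × ℝ) | curveForm κ f.2 f.1 ≤ 1} :=
    measurableSet_le (measurable_curveForm κ (f := fun f : (H × H) × (ℝ × ℝ) => f.2)
      (g := fun f => f.1) (by fun_prop) (by fun_prop)) measurable_const
  have h1 : curvePairBall κ H = MeasurableEquiv.prodAssoc ⁻¹'
      ({f : (ℝ × ℝ) × (H × H) | curveForm κ f.1 f.2 ≤ 1} ×ˢ
        {f : (H × H) × (ℝ × ℝ) | curveForm κ f.2 f.1 ≤ 1}) := by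
    ext ω
    rfl
  have h2 : volume {f : (H × H) × (ℝ × ℝ) | curveForm κ f.2 f.1 ≤ 1} =
      volume {f : (ℝ × ℝ) × (H × H) | curveForm κ f.1 f.2 ≤ 1} := by
    exact (Measure.measurePreserving_swap (μ := (volume : Measure (H × H)))
      (ν := (volume : Measure (ℝ × ℝ)))).measure_preimage hB.nullMeasurableSet
  rw [h1, (volume_preserving_prodAssoc).measure_preimage (hB.prod hB').nullMeasurableSet,
    Measure.volume_eq_prod, Measure.prod_prod, h2, volume_curveForm_le_one hκ, sq,
    ENNReal.ofReal_mul (by positivity)]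

/-- The average number of crossings of two random curves of the unit ball. -/
noncomputable def meanCrossings (P Q : ℝ) (m : ℕ) : ℝ :=
  Real.pi * (Q / P) * (Real.Gamma (m + 2) ^ 2 / ((m + 1) * Real.Gamma (m + 3 / 2) ^ 2))

theorem exists_lintegral_encard_crossings {κ P Q : ℝ} (hκ : 0 < κ) {h h' : ℝ → H}
    (hh : ∀ φ, HasDerivAt h (h' φ) φ) (hc : Continuous h') (hP : ∀ φ, κ + ‖h φ‖ ^ 2 = P)
    (hQ : ∀ φ, ‖h' φ‖ ^ 2 = Q) (horth : ∀ φ, inner ℝ (h φ) (h' φ) = 0) :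
    ∃ n : CurvePair H → ℝ≥0∞, Measurable n ∧
      (∀ᵐ ω, n ω = ((crossings h ω).encard : ℝ≥0∞)) ∧
      ∫⁻ ω in curvePairBall κ H, n ω =
        ENNReal.ofReal (meanCrossings P Q (Module.finrank ℝ H)) *
          volume (curvePairBall κ H) := by
  have hP0 : 0 < P := by
    rw [← hP 0]; positivity
  have hQ0 : 0 ≤ Q := by
    rw [← hQ 0]; positivity
  obtain ⟨n, mn, hn, hint⟩ := exists_measurable_encard_crossings hh hc
  refine ⟨n, mn, hn, ?_⟩
  set m := Module.finrank ℝ H with hm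
  let χ : ℝ → ℝ≥0∞ := (Set.Iic 1).indicator 1
  have mχ : Measurable χ := measurable_one.indicator measurableSet_Iic
  have h1 := hint (fun ω => χ (curveForm κ ω.1.1.1 ω.1.1.2) * χ (curveForm κ ω.2 ω.1.2)) (by
    have h1 := measurable_curveForm κ (f := fun ω : CurvePair H => ω.1.1.1)
      (g := fun ω => ω.1.1.2) (by fun_prop) (by fun_prop)
    have h2 := measurable_curveForm κ (f := fun ω : CurvePair H => ω.2) (g := fun ω => ω.1.2)
      (by fun_prop) (by fun_prop)
    fun_prop)
  have h2 : ∀ ω : CurvePair H, χ (curveForm κ ω.1.1.1 ω.1.1.2) * χ (curveForm κ ω.2 ω.1.2) * n ω =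
      (curvePairBall κ H).indicator n ω := by
    intro ω
    by_cases h1 : curveForm κ ω.1.1.1 ω.1.1.2 ≤ 1 <;> by_cases h2 : curveForm κ ω.2 ω.1.2 ≤ 1 <;>
      simp [χ, curvePairBall, h1, h2, Set.indicator]
  rw [lintegral_congr h2, lintegral_indicator (measurableSet_curvePairBall κ)] at h1
  rw [h1]
  set J : ℝ := (κ / P * Real.pi ^ m) ^ 2 * (Q / 2) / Real.Gamma (m + 3 / 2) ^ 2 with hJ
  have hΓ : 0 < Real.Gamma ((m : ℝ) + 3 / 2) := Real.Gamma_pos_of_pos (by positivity)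
  have hΓ2 : 0 < Real.Gamma ((m : ℝ) + 2) := Real.Gamma_pos_of_pos (by positivity)
  have h3 : ∀ t : ℝ × ℝ, ∫⁻ a : ((ℝ × ℝ) × (H × H)) × (H × H),
      ENNReal.ofReal |crossDet (h' t.1) (h' t.2) a.1.2 a.2| *
        (χ (curveForm κ a.1.1 a.1.2) *
          χ (curveForm κ (linearCurve h a.1.1 a.1.2 t.1 - linearCurve h 0 a.2 t.2) a.2)) =
      ENNReal.ofReal (Real.pi * P / (2 * m + 2) * J) := by
    intro t
    have e1 : ∀ a : ((ℝ × ℝ) × (H × H)) × (H × H),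
        linearCurve h a.1.1 a.1.2 t.1 - linearCurve h 0 a.2 t.2 =
          a.1.1 + innerPair (h t.1) a.1.2 - innerPair (h t.2) a.2 := by
      intro a
      ext <;> simp [linearCurve, innerPair]
    simp_rw [e1]
    rw [lintegral_abs_crossDet_slice hκ (hP t.1) (hP t.2) ((real_inner_comm _ _).trans (horth _))
      ((real_inner_comm _ _).trans (horth _)) mχ]
    have e2 : ∀ w : ℝ × ℝ, ∫⁻ z' : H × H, ∫⁻ z : H × H,
        ENNReal.ofReal |crossDet (h' t.1) (h' t.2) z z'| *
        (χ ((w.1 ^ 2 + w.2 ^ 2) / P + (sliceForm κ (h t.1) z.1 + sliceForm κ (h t.1) z.2)) *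
          χ ((w.1 ^ 2 + w.2 ^ 2) / P + (sliceForm κ (h t.2) z'.1 + sliceForm κ (h t.2) z'.2))) =
        ENNReal.ofReal (max 0 (1 - (w.1 ^ 2 + w.2 ^ 2) / P) ^ (2 * m + 1)) * ENNReal.ofReal J := by
      intro w
      have hJ' := crossMass_eq hκ (hP t.1) (hP t.2) (horth t.1) (horth t.2) (q := √Q)
        (by rw [← hQ t.1, Real.sqrt_sq (norm_nonneg _)])
        (by rw [← hQ t.2, Real.sqrt_sq (norm_nonneg _)])
      rw [Real.sq_sqrt hQ0, ← hm, ← hJ] at hJ'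
      have hs : ∀ a : H, MeasurableSet {z : H × H |
          sliceForm κ a z.1 + sliceForm κ a z.2 ≤ 1 - (w.1 ^ 2 + w.2 ^ 2) / P} := fun a =>
        measurableSet_le (measurable_sliceForm_prod κ a) measurable_const
      rw [← hJ', ← lintegral_abs_crossDet_sublevel hκ, ← lintegral_indicator (hs _)]
      refine lintegral_congr fun z' => ?_
      rw [Set.indicator_apply]
      split_ifs with hz'
      · rw [← lintegral_indicator (hs _)]
        refine lintegral_congr fun z => ?_
        rw [Set.indicator_apply]
        have hz2 : χ ((w.1 ^ 2 + w.2 ^ 2) / P +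
            (sliceForm κ (h t.2) z'.1 + sliceForm κ (h t.2) z'.2)) = 1 :=
          Set.indicator_of_mem (by
            have := hz'.out
            simp only [Set.mem_Iic]
            linarith) _
        rw [hz2, mul_one]
        split_ifs with hz
        · have hz1 : χ ((w.1 ^ 2 + w.2 ^ 2) / P +
              (sliceForm κ (h t.1) z.1 + sliceForm κ (h t.1) z.2)) = 1 :=
            Set.indicator_of_mem (by
              have := hz.out
              simp only [Set.mem_Iic]
              linarith) _
          rw [hz1, mul_one]
        · have hz1 : χ ((w.1 ^ 2 + w.2 ^ 2) / P +
              (sliceForm κ (h t.1) z.1 + sliceForm κ (h t.1) z.2)) = 0 :=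
            Set.indicator_of_notMem (by
              simp only [Set.mem_ofPred_eq, not_le, Set.mem_Iic] at hz ⊢
              linarith) _
          rw [hz1, mul_zero]
      · have hz2 : χ ((w.1 ^ 2 + w.2 ^ 2) / P +
            (sliceForm κ (h t.2) z'.1 + sliceForm κ (h t.2) z'.2)) = 0 :=
          Set.indicator_of_notMem (by
            simp only [Set.mem_ofPred_eq, not_le, Set.mem_Iic] at hz' ⊢
            linarith) _
        simp [hz2]
    rw [lintegral_congr e2, lintegral_mul_const' _ _ ENNReal.ofReal_ne_top,
      lintegral_pow_max_one_sub_norm_sq hP0 (by positivity), ← ENNReal.ofReal_mul (by positivity)]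
    congr 2
    push_cast
    ring
  rw [lintegral_congr h3, lintegral_const, Measure.restrict_apply_univ, Measure.volume_eq_prod,
    Measure.prod_prod, Real.volume_Ico, volume_curvePairBall hκ, sub_zero,
    ← ENNReal.ofReal_mul (by positivity), ← ENNReal.ofReal_mul (by positivity), meanCrossings,
    ← ENNReal.ofReal_mul (by positivity), ← hm]
  congr 1
  rw [hJ]
  field_simp
  ring

end KacRice

section Multiple

variable {W : Type*} [NormedAddCommGroup W] [NormedSpace ℝ W] [FiniteDimensional ℝ W]
  [MeasurableSpace W] [BorelSpace W]

/-- The parameters `φ`, `φ'` and `ψ` exhibit a point that the first curve visits twice and the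
second curve visits as well; `η` tells `φ` and `φ'` apart. -/
def doublePointCrossings (p : W → ℝ → ℝ × ℝ) (η : ℝ → ℝ) : Set (W × W) :=
  {x | ∃ φ φ' ψ, η φ ≠ η φ' ∧ p x.1 φ = p x.1 φ' ∧ p x.1 φ = p x.2 ψ}

theorem measurableSet_doublePointCrossings {p : W → ℝ → ℝ × ℝ} {η : ℝ → ℝ}
    (hp : Continuous (Function.uncurry p)) (hη : Continuous η) :
    MeasurableSet (doublePointCrossings p η) := by
  have : ProperSpace W := FiniteDimensional.proper_real W
  let K : ℕ → Set (ℝ × ℝ × ℝ) := fun k => Metric.closedBall 0 k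
  have hp' : ∀ {X : Type _} [TopologicalSpace X] {f : X → W} {g : X → ℝ}, Continuous f →
      Continuous g → Continuous fun x => p (f x) (g x) := fun hf hg => hp.comp (hf.prodMk hg)
  let C : ∀ k : ℕ, Set ((W × W) × K k) := fun k =>
    {x | 1 / ((k : ℝ) + 1) ≤ |η x.2.1.1 - η x.2.1.2.1| ∧
      p x.1.1 x.2.1.1 = p x.1.1 x.2.1.2.1 ∧ p x.1.1 x.2.1.1 = p x.1.2 x.2.1.2.2}
  have hC : ∀ k, IsClosed (C k) := by
    intro k
    refine (isClosed_le continuous_const (by fun_prop : Continuous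
      fun x : (W × W) × K k => |η x.2.1.1 - η x.2.1.2.1|)).inter
      ((isClosed_eq (hp' (by fun_prop) (by fun_prop)) (hp' (by fun_prop) (by fun_prop))).inter
        (isClosed_eq (hp' (by fun_prop) (by fun_prop)) (hp' (by fun_prop) (by fun_prop))))
  have hS : doublePointCrossings p η = ⋃ k, Prod.fst '' C k := by
    ext x
    simp only [doublePointCrossings, Set.mem_ofPred_eq, Set.mem_iUnion, Set.mem_image]
    constructor
    · rintro ⟨φ, φ', ψ, h1, h2, h3⟩
      obtain ⟨k₁, hk₁⟩ := exists_nat_one_div_lt (abs_pos.2 (sub_ne_zero.2 h1))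
      obtain ⟨k₂, hk₂⟩ := exists_nat_ge ‖((φ, φ', ψ) : ℝ × ℝ × ℝ)‖
      refine ⟨max k₁ k₂, (x, ⟨(φ, φ', ψ), ?_⟩), ⟨?_, h2, h3⟩, rfl⟩
      · rw [Metric.mem_closedBall, dist_zero_right]
        exact hk₂.trans (by exact_mod_cast le_max_right _ _)
      · refine le_trans ?_ hk₁.le
        gcongr
        exact_mod_cast le_max_left _ _
    · rintro ⟨k, ⟨y, ⟨⟨φ, φ', ψ⟩, ht⟩⟩, ⟨h1, h2, h3⟩, rfl⟩
      refine ⟨φ, φ', ψ, fun h => ?_, h2, h3⟩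
      simp only [h, sub_self, abs_zero] at h1
      exact absurd h1 (not_le.2 (by positivity))
  rw [hS]
  refine MeasurableSet.iUnion fun k => IsClosed.measurableSet ?_
  have : CompactSpace (K k) := isCompact_iff_compactSpace.1 (isCompact_closedBall _ _)
  exact isClosedMap_fst_of_compactSpace _ (hC k)

theorem measure_doublePointCrossings (ν : Measure (W × W)) [ν.IsAddHaarMeasure]
    {p : W → ℝ → ℝ × ℝ} {η : ℝ → ℝ} (hp : Continuous (Function.uncurry p))
    (hpd : ∀ f, Differentiable ℝ (p f)) (hη : Differentiable ℝ η) (e k : ℝ × ℝ →ₗ[ℝ] W)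
    (he : ∀ f s φ, p (f + e s) φ = p f φ + η φ • s) (hk : ∀ f c φ, p (f + k c) φ = p f φ + c) :
    ν (doublePointCrossings p η) = 0 := by
  have hm := measurableSet_doublePointCrossings hp hη.continuous
  let L : (ℝ × ℝ) × (ℝ × ℝ) →ₗ[ℝ] W × W := e.prodMap k
  rw [measure_eq_zero_iff_ae_notMem]
  change ∀ᵐ x ∂ν, x ∈ (doublePointCrossings p η)ᶜ
  rw [← ae_ae_add_linearMap_mem_iff L (volume.prod volume) ν hm.compl]
  refine ae_of_all _ fun x => ?_
  obtain ⟨f, g⟩ := x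
  let U : Set ((ℝ × ℝ) × (ℝ × ℝ)) := {t | η t.1.1 ≠ η t.1.2}
  let s : ℝ × ℝ → ℝ × ℝ := fun t => -((η t.1 - η t.2)⁻¹ • (p f t.1 - p f t.2))
  let Θ : (ℝ × ℝ) × (ℝ × ℝ) → (ℝ × ℝ) × (ℝ × ℝ) := fun t =>
    (s t.1, p f t.1.1 + η t.1.1 • s t.1 - p g t.2.1)
  have hΘ : ∀ t ∈ U, HasFDerivAt Θ (fderiv ℝ Θ t) t := by
    intro t ht
    refine DifferentiableAt.hasFDerivAt ?_
    have h0 : η t.1.1 - η t.1.2 ≠ 0 := sub_ne_zero.2 ht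
    have h1 : ∀ f, ∀ {v : (ℝ × ℝ) × (ℝ × ℝ) → ℝ}, Differentiable ℝ v →
        DifferentiableAt ℝ (fun t => p f (v t)) t := fun f v hv =>
      ((hpd f).comp hv).differentiableAt
    have h2 : ∀ {v : (ℝ × ℝ) × (ℝ × ℝ) → ℝ}, Differentiable ℝ v →
        DifferentiableAt ℝ (fun t => η (v t)) t := fun hv => (hη.comp hv).differentiableAt
    have hs : DifferentiableAt ℝ (fun t : (ℝ × ℝ) × (ℝ × ℝ) => s t.1) t :=
      ((((h2 (by fun_prop)).sub (h2 (by fun_prop))).inv h0).smul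
        ((h1 f (by fun_prop)).sub (h1 f (by fun_prop)))).neg
    exact hs.prodMk (((h1 f (by fun_prop)).add ((h2 (by fun_prop)).smul hs)).sub
      (h1 g (by fun_prop)))
  have hdet : ∀ t ∈ U, (fderiv ℝ Θ t).det = 0 := by
    intro t ht
    rw [ContinuousLinearMap.det, LinearMap.det_eq_zero_iff_ker_ne_bot]
    have hl : HasDerivAt (fun r : ℝ => (t.1, (t.2.1, r))) (((0 : ℝ × ℝ)), ((0 : ℝ), (1 : ℝ))) t.2.2 :=
      (hasDerivAt_const _ _).prodMk ((hasDerivAt_const _ _).prodMk (hasDerivAt_id _))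
    have h2 := HasFDerivAt.comp_hasDerivAt t.2.2 (f := fun r : ℝ => (t.1, (t.2.1, r)))
      (hΘ t ht) hl
    have h3 : HasDerivAt (Θ ∘ fun r : ℝ => (t.1, (t.2.1, r))) 0 t.2.2 :=
      hasDerivAt_const (c := Θ (t.1, (t.2.1, 0))) _
    intro hbot
    have h4 : (((0 : ℝ × ℝ)), ((0 : ℝ), (1 : ℝ))) ∈
        LinearMap.ker ((fderiv ℝ Θ t : (ℝ × ℝ) × (ℝ × ℝ) →L[ℝ] (ℝ × ℝ) × (ℝ × ℝ)) :
          (ℝ × ℝ) × (ℝ × ℝ) →ₗ[ℝ] (ℝ × ℝ) × (ℝ × ℝ)) := h2.unique h3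
    rw [hbot, Submodule.mem_bot] at h4
    simp at h4
  have hnull := addHaar_image_eq_zero_of_det_fderivWithin_eq_zero
    ((volume : Measure (ℝ × ℝ)).prod (volume : Measure (ℝ × ℝ)))
    (fun t ht => (hΘ t ht).hasFDerivWithinAt) hdet
  filter_upwards [measure_eq_zero_iff_ae_notMem.1 hnull] with y hy hmem
  refine hy ?_
  obtain ⟨φ, φ', ψ, h1, h2, h3⟩ := hmem
  have e1 : ((f, g) + L y).1 = f + e y.1 := rfl
  have e2 : ((f, g) + L y).2 = g + k y.2 := rfl
  rw [e1, he, he] at h2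
  rw [e1, e2, he, hk] at h3
  have h0 : η φ - η φ' ≠ 0 := sub_ne_zero.2 h1
  have hs : s (φ, φ') = y.1 := by
    have h4 : p f φ - p f φ' = -((η φ - η φ') • y.1) := by
      rw [sub_smul, neg_sub, sub_eq_sub_iff_add_eq_add, h2, add_comm]
    change -((η φ - η φ')⁻¹ • (p f φ - p f φ')) = y.1
    rw [h4, smul_neg, neg_neg, smul_smul, inv_mul_cancel₀ h0, one_smul]
  refine ⟨((φ, φ'), (ψ, 0)), h1, Prod.ext hs ?_⟩
  change p f φ + η φ • s (φ, φ') - p g ψ = y.2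
  rw [hs, h3, add_sub_cancel_left]

end Multiple

section Trig

/-- The weight `∑_{q ≤ r} j^{2q}` of the `j`-th Fourier coefficient in the `W_2^r` metric. -/
noncomputable def sobolevWeight (r j : ℕ) : ℝ := ∑ q ∈ Finset.range (r + 1), (j : ℝ) ^ (2 * q)

theorem one_le_sobolevWeight (r j : ℕ) : 1 ≤ sobolevWeight r j := by
  unfold sobolevWeight
  rw [Finset.sum_range_succ']
  have : 0 ≤ ∑ q ∈ Finset.range r, (j : ℝ) ^ (2 * (q + 1)) :=
    Finset.sum_nonneg fun q _ => by positivity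
  simpa using this

theorem sobolevWeight_pos (r j : ℕ) : 0 < sobolevWeight r j :=
  one_pos.trans_le (one_le_sobolevWeight r j)

/-- The derivative of a trigonometric polynomial. -/
def TrigPoly.deriv {N : ℕ} (p : TrigPoly N) : TrigPoly N :=
  (Fin.cons 0 fun j => ((j : ℕ) + 1 : ℝ) * p.2 j, fun j => -(((j : ℕ) + 1 : ℝ) * p.1 j.succ))

theorem TrigPoly.eval_eq {N : ℕ} (p : TrigPoly N) (φ : ℝ) :
    p.eval φ = p.1 0 + ∑ j : Fin N, (p.1 j.succ * Real.cos (((j : ℕ) + 1) * φ) +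
      p.2 j * Real.sin (((j : ℕ) + 1) * φ)) := by
  rw [TrigPoly.eval, Fin.sum_univ_succ, Finset.sum_add_distrib]
  simp [add_assoc]

theorem TrigPoly.hasDerivAt_eval {N : ℕ} (p : TrigPoly N) (φ : ℝ) :
    HasDerivAt p.eval (p.deriv.eval φ) φ := by
  have hfun : p.eval = fun φ => p.1 0 + ∑ j : Fin N,
      (p.1 j.succ * Real.cos (((j : ℕ) + 1) * φ) + p.2 j * Real.sin (((j : ℕ) + 1) * φ)) :=
    funext p.eval_eq
  have hlin : ∀ j : Fin N, HasDerivAt (fun φ : ℝ => ((j : ℕ) + 1 : ℝ) * φ) ((j : ℕ) + 1 : ℝ) φ :=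
    fun j => by simpa using (hasDerivAt_id φ).const_mul ((j : ℕ) + 1 : ℝ)
  rw [hfun]
  refine (HasDerivAt.const_add _ (HasDerivAt.fun_sum fun j _ =>
    ((hlin j).cos.const_mul _).add ((hlin j).sin.const_mul _))).congr_deriv ?_
  rw [TrigPoly.eval_eq]
  simp only [TrigPoly.deriv, Fin.cons_zero, Fin.cons_succ, zero_add]
  exact Finset.sum_congr rfl fun j _ => by ring

theorem TrigPoly.continuous_eval {N : ℕ} (p : TrigPoly N) : Continuous p.eval :=
  continuous_iff_continuousAt.2 fun φ => (p.hasDerivAt_eval φ).continuousAt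

theorem TrigPoly.iteratedDeriv_eval {N : ℕ} (q : ℕ) (p : TrigPoly N) :
    iteratedDeriv q p.eval = (TrigPoly.deriv^[q] p).eval := by
  induction q generalizing p with
  | zero => simp
  | succ q ih =>
    rw [iteratedDeriv_succ', Function.iterate_succ_apply, ← ih,
      show _root_.deriv p.eval = p.deriv.eval from funext fun φ => (p.hasDerivAt_eval φ).deriv]

/-- The squares of the amplitudes of a trigonometric polynomial. -/
def TrigPoly.ampSq {N : ℕ} (p : TrigPoly N) (j : Fin N) : ℝ := p.1 j.succ ^ 2 + p.2 j ^ 2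

theorem TrigPoly.ampSq_iterate_deriv {N : ℕ} (q : ℕ) (p : TrigPoly N) (j : Fin N) :
    (TrigPoly.deriv^[q] p).ampSq j = ((j : ℕ) + 1 : ℝ) ^ (2 * q) * p.ampSq j := by
  induction q generalizing p with
  | zero => simp
  | succ q ih =>
    rw [Function.iterate_succ_apply, ih]
    simp only [TrigPoly.ampSq, TrigPoly.deriv, Fin.cons_succ]
    ring

theorem integral_cos_int_mul {m : ℤ} (hm : m ≠ 0) :
    ∫ φ in (0 : ℝ)..2 * Real.pi, Real.cos (m * φ) = 0 := by
  have hm' : (m : ℝ) ≠ 0 := by exact_mod_cast hm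
  rw [intervalIntegral.integral_comp_mul_left (fun x => Real.cos x) hm', integral_cos, mul_zero,
    Real.sin_zero, sub_zero]
  have : Real.sin (m * (2 * Real.pi)) = 0 := by
    have := Real.sin_int_mul_pi (m * 2)
    push_cast at this
    rw [← this]
    congr 1
    ring
  rw [this, smul_zero]

theorem integral_sin_int_mul (m : ℤ) : ∫ φ in (0 : ℝ)..2 * Real.pi, Real.sin (m * φ) = 0 := by
  rcases eq_or_ne m 0 with rfl | hm
  · simp
  have hm' : (m : ℝ) ≠ 0 := by exact_mod_cast hm
  rw [intervalIntegral.integral_comp_mul_left (fun x => Real.sin x) hm', integral_sin, mul_zero,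
    Real.cos_zero]
  have : Real.cos (m * (2 * Real.pi)) = 1 := Real.cos_int_mul_two_pi m
  rw [this, sub_self, smul_zero]

theorem integral_wave_mul_wave (m n : ℤ) (a b a' b' : ℝ) :
    ∫ φ in (0 : ℝ)..2 * Real.pi, (a * Real.cos (m * φ) + b * Real.sin (m * φ)) *
      (a' * Real.cos (n * φ) + b' * Real.sin (n * φ)) =
    (a * a' + b * b') / 2 * (∫ φ in (0 : ℝ)..2 * Real.pi, Real.cos ((m - n : ℤ) * φ)) +
      (a * a' - b * b') / 2 * (∫ φ in (0 : ℝ)..2 * Real.pi, Real.cos ((m + n : ℤ) * φ)) := by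
  have e : ∀ φ : ℝ, (a * Real.cos (m * φ) + b * Real.sin (m * φ)) *
      (a' * Real.cos (n * φ) + b' * Real.sin (n * φ)) =
      ((a * a' + b * b') / 2 * Real.cos ((m - n : ℤ) * φ) +
      (a * a' - b * b') / 2 * Real.cos ((m + n : ℤ) * φ)) +
      ((b * a' - a * b') / 2 * Real.sin ((m - n : ℤ) * φ) +
      (b * a' + a * b') / 2 * Real.sin ((m + n : ℤ) * φ)) := by
    intro φ
    push_cast
    rw [sub_mul (m : ℝ), add_mul (m : ℝ), Real.cos_sub, Real.cos_add, Real.sin_sub, Real.sin_add]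
    ring
  have hi : ∀ f : ℝ → ℝ, Continuous f → IntervalIntegrable f volume 0 (2 * Real.pi) :=
    fun f hf => hf.intervalIntegrable _ _
  simp_rw [e]
  rw [intervalIntegral.integral_add (hi _ (by fun_prop)) (hi _ (by fun_prop)),
    intervalIntegral.integral_add (hi _ (by fun_prop)) (hi _ (by fun_prop)),
    intervalIntegral.integral_add (hi _ (by fun_prop)) (hi _ (by fun_prop))]
  simp only [intervalIntegral.integral_const_mul, integral_sin_int_mul, mul_zero, add_zero]

theorem TrigPoly.integral_eval_mul_self {N : ℕ} (p : TrigPoly N) :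
    ∫ φ in (0 : ℝ)..2 * Real.pi, p.eval φ * p.eval φ =
      Real.pi * (2 * p.1 0 ^ 2 + ∑ j, p.ampSq j) := by
  let w : Option (Fin N) → ℝ → ℝ := fun o φ => match o with
    | none => p.1 0 * Real.cos ((0 : ℤ) * φ) + 0 * Real.sin ((0 : ℤ) * φ)
    | some j => p.1 j.succ * Real.cos (((j : ℕ) + 1 : ℤ) * φ) +
      p.2 j * Real.sin (((j : ℕ) + 1 : ℤ) * φ)
  have hw : ∀ φ, p.eval φ = ∑ o, w o φ := by
    intro φ
    rw [TrigPoly.eval_eq, Fintype.sum_option]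
    simp [w]
  have hc : ∀ o, Continuous (w o) := by
    rintro (_ | j) <;> simp only [w] <;> fun_prop
  have hwave : ∀ o o', o ≠ o' → ∫ φ in (0 : ℝ)..2 * Real.pi, w o φ * w o' φ = 0 := by
    rintro (_ | i) (_ | j) hne
    · exact absurd rfl hne
    · simp only [w]
      rw [integral_wave_mul_wave, integral_cos_int_mul (by omega), integral_cos_int_mul (by omega)]
      ring
    · simp only [w]
      rw [integral_wave_mul_wave, integral_cos_int_mul (by omega), integral_cos_int_mul (by omega)]
      ring
    · simp only [w]
      have hij : (i : ℕ) ≠ j := fun h => hne (congrArg some (Fin.ext h))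
      rw [integral_wave_mul_wave, integral_cos_int_mul (by omega), integral_cos_int_mul (by omega)]
      ring
  simp_rw [hw, Finset.sum_mul_sum]
  have hcc : ∀ o o', Continuous fun φ => w o φ * w o' φ := fun o o' => (hc o).mul (hc o')
  rw [intervalIntegral.integral_finsetSum fun o _ => Continuous.intervalIntegrable
    (continuous_finsetSum _ fun o' _ => hcc o o') _ _]
  have e : ∀ o, ∫ φ in (0 : ℝ)..2 * Real.pi, ∑ o', w o φ * w o' φ =
      ∫ φ in (0 : ℝ)..2 * Real.pi, w o φ * w o φ := by
    intro o
    rw [intervalIntegral.integral_finsetSum fun o' _ => (hcc o o').intervalIntegrable _ _]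
    exact Finset.sum_eq_single o (fun o' _ h => hwave o o' h.symm) (by simp)
  simp_rw [e]
  rw [Fintype.sum_option, mul_add, Finset.mul_sum]
  congr 1
  · simp only [w]
    rw [integral_wave_mul_wave]
    simp
    ring
  · refine Finset.sum_congr rfl fun j _ => ?_
    simp only [w]
    rw [integral_wave_mul_wave, integral_cos_int_mul (m := ((j : ℕ) + 1 + ((j : ℕ) + 1) : ℤ))
      (by omega)]
    simp [TrigPoly.ampSq]
    ring

theorem sobolevDot_self (r : ℕ) {N : ℕ} (f : TrigCurve N) :
    sobolevDot r f f = (2 * f.1.1 0 ^ 2 + ∑ j : Fin N, sobolevWeight r (j + 1) * f.1.ampSq j) +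
      (2 * f.2.1 0 ^ 2 + ∑ j : Fin N, sobolevWeight r (j + 1) * f.2.ampSq j) := by
  have key : ∀ p : TrigPoly N, ∑ q ∈ Finset.range (r + 1),
      (2 * (TrigPoly.deriv^[q] p).1 0 ^ 2 + ∑ j, (TrigPoly.deriv^[q] p).ampSq j) =
      2 * p.1 0 ^ 2 + ∑ j : Fin N, sobolevWeight r (j + 1) * p.ampSq j := by
    intro p
    rw [Finset.sum_add_distrib, Finset.sum_comm]
    congr 1
    · rw [Finset.sum_range_succ']
      simp [Function.iterate_succ_apply', TrigPoly.deriv]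
    · refine Finset.sum_congr rfl fun j _ => ?_
      simp_rw [TrigPoly.ampSq_iterate_deriv]
      rw [← Finset.sum_mul, sobolevWeight]
      push_cast
      rfl
  rw [sobolevDot]
  simp_rw [TrigPoly.iteratedDeriv_eval]
  have hc : ∀ (p : TrigPoly N), IntervalIntegrable (fun φ => p.eval φ * p.eval φ) volume 0
      (2 * Real.pi) := fun p =>
    (p.continuous_eval.mul p.continuous_eval).intervalIntegrable _ _
  rw [intervalIntegral.integral_finsetSum fun q _ => (hc _).add (hc _)]
  simp_rw [intervalIntegral.integral_add (hc _) (hc _), TrigPoly.integral_eval_mul_self]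
  rw [← key, ← key, ← Finset.sum_add_distrib, Finset.mul_sum]
  refine Finset.sum_congr rfl fun q _ => ?_
  field_simp

end Trig

section Coordinates

/-- The Euclidean space of the nonconstant Fourier coefficients. -/
abbrev FourierSpace (N : ℕ) : Type := EuclideanSpace ℝ (Fin N ⊕ Fin N)

variable (r N : ℕ)

/-- The nonconstant Fourier modes, normalized in the `W_2^r` metric. -/
noncomputable def fourierCurve (φ : ℝ) : FourierSpace N :=
  WithLp.toLp 2 (Sum.elim
    (fun j : Fin N => Real.cos (((j : ℕ) + 1) * φ) / √(sobolevWeight r (j + 1)))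
    (fun j : Fin N => Real.sin (((j : ℕ) + 1) * φ) / √(sobolevWeight r (j + 1))))

/-- The derivative of `fourierCurve`. -/
noncomputable def fourierCurveDeriv (φ : ℝ) : FourierSpace N :=
  WithLp.toLp 2 (Sum.elim
    (fun j : Fin N =>
      -Real.sin (((j : ℕ) + 1) * φ) * ((j : ℕ) + 1) / √(sobolevWeight r (j + 1)))
    (fun j : Fin N =>
      Real.cos (((j : ℕ) + 1) * φ) * ((j : ℕ) + 1) / √(sobolevWeight r (j + 1))))

theorem hasDerivAt_fourierCurve (φ : ℝ) :
    HasDerivAt (fourierCurve r N) (fourierCurveDeriv r N φ) φ := by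
  have hlin : ∀ j : Fin N, HasDerivAt (fun φ : ℝ => ((j : ℕ) + 1 : ℝ) * φ) ((j : ℕ) + 1 : ℝ) φ :=
    fun j => by simpa using (hasDerivAt_id φ).const_mul ((j : ℕ) + 1 : ℝ)
  refine HasFDerivAt.comp_hasDerivAt φ
    (PiLp.continuousLinearEquiv 2 ℝ fun _ : Fin N ⊕ Fin N => ℝ).symm.hasFDerivAt
    (hasDerivAt_pi.2 ?_)
  rintro (j | j)
  · exact (hlin j).cos.div_const _
  · exact (hlin j).sin.div_const _

theorem continuous_fourierCurveDeriv : Continuous (fourierCurveDeriv r N) := by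
  refine (PiLp.continuousLinearEquiv 2 ℝ fun _ : Fin N ⊕ Fin N => ℝ).symm.continuous.comp
    (continuous_pi ?_)
  rintro (j | j) <;> simp only [Sum.elim_inl, Sum.elim_inr] <;> fun_prop

/-- `∑_{1 ≤ j ≤ N} j^{2 s} / c_j`, where `c_j` is the Sobolev weight. -/
noncomputable def weightSum (s : ℕ) : ℝ :=
  ∑ j ∈ Finset.range N, ((j : ℝ) + 1) ^ (2 * s) / sobolevWeight r (j + 1)

theorem norm_sq_fourierCurve (φ : ℝ) : ‖fourierCurve r N φ‖ ^ 2 = weightSum r N 0 := by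
  rw [EuclideanSpace.real_norm_sq_eq, Fintype.sum_sum_type, ← Finset.sum_add_distrib, weightSum,
    ← Fin.sum_univ_eq_sum_range (fun j => ((j : ℝ) + 1) ^ (2 * 0) / sobolevWeight r (j + 1))]
  refine Finset.sum_congr rfl fun j _ => ?_
  simp only [fourierCurve, Sum.elim_inl, Sum.elim_inr, div_pow,
    Real.sq_sqrt (sobolevWeight_pos r _).le]
  rw [← add_div, Real.cos_sq_add_sin_sq, mul_zero, pow_zero]

theorem norm_sq_fourierCurveDeriv (φ : ℝ) : ‖fourierCurveDeriv r N φ‖ ^ 2 = weightSum r N 1 := by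
  rw [EuclideanSpace.real_norm_sq_eq, Fintype.sum_sum_type, ← Finset.sum_add_distrib, weightSum,
    ← Fin.sum_univ_eq_sum_range (fun j => ((j : ℝ) + 1) ^ (2 * 1) / sobolevWeight r (j + 1))]
  refine Finset.sum_congr rfl fun j _ => ?_
  simp only [fourierCurveDeriv, Sum.elim_inl, Sum.elim_inr, div_pow,
    Real.sq_sqrt (sobolevWeight_pos r _).le]
  rw [← add_div]
  congr 1
  linear_combination ((j : ℝ) + 1) ^ 2 * Real.sin_sq_add_cos_sq ((((j : ℕ) : ℝ) + 1) * φ)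

theorem inner_fourierCurve_deriv (φ : ℝ) :
    inner ℝ (fourierCurve r N φ) (fourierCurveDeriv r N φ) = 0 := by
  rw [PiLp.inner_apply, Fintype.sum_sum_type, ← Finset.sum_add_distrib]
  refine Finset.sum_eq_zero fun j _ => ?_
  simp [fourierCurve, fourierCurveDeriv]
  ring

/-- The coordinates of a trigonometric polynomial: the constant term and the nonconstant
coefficients, normalized in the `W_2^r` metric. -/
noncomputable def trigPolyEquiv : TrigPoly N ≃ₗ[ℝ] ℝ × FourierSpace N where
  toFun p := (p.1 0, WithLp.toLp 2 (Sum.elim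
    (fun j : Fin N => √(sobolevWeight r (j + 1)) * p.1 j.succ)
    (fun j : Fin N => √(sobolevWeight r (j + 1)) * p.2 j)))
  invFun x := (Fin.cons x.1 fun j : Fin N => x.2 (Sum.inl j) / √(sobolevWeight r (j + 1)),
    fun j : Fin N => x.2 (Sum.inr j) / √(sobolevWeight r (j + 1)))
  map_add' p p' := by
    ext i
    · rfl
    · rcases i with j | j <;> simp [mul_add]
  map_smul' c p := by
    ext i
    · rfl
    · rcases i with j | j <;> simp <;> ring
  left_inv p := by
    have h : ∀ j, √(sobolevWeight r j) ≠ 0 := fun j => (Real.sqrt_pos.2 (sobolevWeight_pos r j)).ne'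
    ext j
    · refine Fin.cases ?_ (fun j => ?_) j
      · rfl
      · simp [h]
    · simp [h]
  right_inv x := by
    have h : ∀ j, √(sobolevWeight r j) ≠ 0 := fun j => (Real.sqrt_pos.2 (sobolevWeight_pos r j)).ne'
    ext i
    · rfl
    · rcases i with j | j <;> simp [mul_div_cancel₀, h]

variable {N}

theorem trigPolyEquiv_eval (p : TrigPoly N) (φ : ℝ) :
    p.eval φ = (trigPolyEquiv r N p).1 + inner ℝ (fourierCurve r N φ) (trigPolyEquiv r N p).2 := by
  have h : ∀ j, √(sobolevWeight r j) ≠ 0 := fun j => (Real.sqrt_pos.2 (sobolevWeight_pos r j)).ne'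
  rw [TrigPoly.eval_eq, PiLp.inner_apply, Fintype.sum_sum_type, ← Finset.sum_add_distrib]
  congr 1
  refine Finset.sum_congr rfl fun j _ => ?_
  have := h (j + 1)
  simp [fourierCurve, trigPolyEquiv]
  field_simp

theorem trigPolyEquiv_norm_sq (p : TrigPoly N) :
    ‖(trigPolyEquiv r N p).2‖ ^ 2 = ∑ j : Fin N, sobolevWeight r (j + 1) * p.ampSq j := by
  rw [EuclideanSpace.real_norm_sq_eq, Fintype.sum_sum_type, ← Finset.sum_add_distrib]
  refine Finset.sum_congr rfl fun j _ => ?_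
  simp only [trigPolyEquiv, LinearEquiv.coe_mk, LinearMap.coe_mk, AddHom.coe_mk, Sum.elim_inl,
    Sum.elim_inr, mul_pow, Real.sq_sqrt (sobolevWeight_pos r _).le, TrigPoly.ampSq]
  ring

variable (N)

/-- The coordinates of a pair of curves. -/
noncomputable def curvePairEquiv :
    (TrigCurve N × TrigCurve N) ≃ₗ[ℝ] CurvePair (FourierSpace N) where
  toFun x := (((((trigPolyEquiv r N x.1.1).1, (trigPolyEquiv r N x.1.2).1),
    ((trigPolyEquiv r N x.1.1).2, (trigPolyEquiv r N x.1.2).2)),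
    ((trigPolyEquiv r N x.2.1).2, (trigPolyEquiv r N x.2.2).2)),
    ((trigPolyEquiv r N x.2.1).1, (trigPolyEquiv r N x.2.2).1))
  invFun ω := (((trigPolyEquiv r N).symm (ω.1.1.1.1, ω.1.1.2.1),
    (trigPolyEquiv r N).symm (ω.1.1.1.2, ω.1.1.2.2)),
    ((trigPolyEquiv r N).symm (ω.2.1, ω.1.2.1), (trigPolyEquiv r N).symm (ω.2.2, ω.1.2.2)))
  map_add' x y := by simp
  map_smul' c x := by simp
  left_inv x := by simp
  right_inv ω := by simp

variable {N}

theorem curvePairEquiv_mem_ball (x : TrigCurve N × TrigCurve N) :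
    curvePairEquiv r N x ∈ curvePairBall (1 / 2) (FourierSpace N) ↔
      x ∈ sobolevBall r N ×ˢ sobolevBall r N := by
  have h : ∀ f : TrigCurve N, curveForm (1 / 2)
      ((trigPolyEquiv r N f.1).1, (trigPolyEquiv r N f.2).1)
      ((trigPolyEquiv r N f.1).2, (trigPolyEquiv r N f.2).2) = sobolevDot r f f := by
    intro f
    rw [sobolevDot_self, curveForm, trigPolyEquiv_norm_sq, trigPolyEquiv_norm_sq]
    simp only [trigPolyEquiv, LinearEquiv.coe_mk, LinearMap.coe_mk, AddHom.coe_mk]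
    ring
  simp only [curvePairBall, curvePairEquiv, sobolevBall, Set.mem_prod, Set.mem_ofPred_eq, ← h]
  rfl

theorem crossings_curvePairEquiv (x : TrigCurve N × TrigCurve N) :
    crossings (fourierCurve r N) (curvePairEquiv r N x) =
      {t | t ∈ Set.Ico 0 (2 * Real.pi) ×ˢ Set.Ico 0 (2 * Real.pi) ∧
        x.1.param t.1 = x.2.param t.2} := by
  simp only [TrigCurve.param, trigPolyEquiv_eval r]
  rfl

end Coordinates

section Points

variable {N : ℕ}

theorem TrigPoly.eval_periodic (p : TrigPoly N) : Function.Periodic p.eval (2 * Real.pi) := by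
  intro φ
  rw [TrigPoly.eval_eq, TrigPoly.eval_eq]
  congr 1
  refine Finset.sum_congr rfl fun j _ => ?_
  have h : (((j : ℕ) : ℝ) + 1) * (φ + 2 * Real.pi) =
      (((j : ℕ) : ℝ) + 1) * φ + ((j + 1 : ℕ) : ℝ) * (2 * Real.pi) := by
    push_cast
    ring
  rw [h, Real.cos_add_nat_mul_two_pi, Real.sin_add_nat_mul_two_pi]

theorem TrigCurve.param_periodic (f : TrigCurve N) :
    Function.Periodic f.param (2 * Real.pi) := fun φ =>
  Prod.ext (f.1.eval_periodic φ) (f.2.eval_periodic φ)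

theorem TrigCurve.exists_param_eq (f : TrigCurve N) (φ : ℝ) :
    ∃ θ ∈ Set.Ico 0 (2 * Real.pi), f.param θ = f.param φ := by
  obtain ⟨θ, hθ, h⟩ := f.param_periodic.exists_mem_Ico₀ Real.two_pi_pos φ
  exact ⟨θ, hθ, h.symm⟩

theorem intersectionPoints_eq_image (f g : TrigCurve N) :
    intersectionPoints f g = (fun t : ℝ × ℝ => f.param t.1) ''
      {t | t ∈ Set.Ico 0 (2 * Real.pi) ×ˢ Set.Ico 0 (2 * Real.pi) ∧ f.param t.1 = g.param t.2} := by
  ext y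
  constructor
  · rintro ⟨⟨φ, rfl⟩, ⟨ψ, hψ⟩⟩
    obtain ⟨θ, hθ, h1⟩ := f.exists_param_eq φ
    obtain ⟨θ', hθ', h2⟩ := g.exists_param_eq ψ
    exact ⟨(θ, θ'), ⟨⟨hθ, hθ'⟩, by rw [h1, h2, hψ]⟩, h1⟩
  · rintro ⟨t, ⟨-, ht⟩, rfl⟩
    exact ⟨⟨t.1, rfl⟩, ⟨t.2, ht.symm⟩⟩

/-- Adding a multiple of a fixed trigonometric polynomial to each coordinate of a curve. -/
def TrigCurve.scale (e : TrigPoly N) : ℝ × ℝ →ₗ[ℝ] TrigCurve N :=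
  (LinearMap.toSpanSingleton ℝ (TrigPoly N) e).prodMap (LinearMap.toSpanSingleton ℝ (TrigPoly N) e)

theorem TrigPoly.eval_add_smul (p e : TrigPoly N) (s φ : ℝ) :
    (p + s • e).eval φ = p.eval φ + s * e.eval φ := by
  simp only [TrigPoly.eval_eq, Prod.fst_add, Prod.snd_add, Prod.smul_fst, Prod.smul_snd,
    Pi.add_apply, Pi.smul_apply, smul_eq_mul]
  rw [mul_add, Finset.mul_sum, add_add_add_comm, ← Finset.sum_add_distrib]
  congr 1
  exact Finset.sum_congr rfl fun j _ => by ring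

theorem TrigCurve.param_add_scale (f : TrigCurve N) (e : TrigPoly N) (s : ℝ × ℝ) (φ : ℝ) :
    (f + TrigCurve.scale e s).param φ = f.param φ + e.eval φ • s := by
  have h1 := f.1.eval_add_smul e s.1 φ
  have h2 := f.2.eval_add_smul e s.2 φ
  refine Prod.ext ?_ ?_
  · rw [mul_comm] at h1
    exact h1
  · rw [mul_comm] at h2
    exact h2

theorem TrigCurve.continuous_uncurry_param :
    Continuous (Function.uncurry fun (f : TrigCurve N) φ => f.param φ) := by
  unfold TrigCurve.param TrigPoly.eval Function.uncurry
  fun_prop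

theorem TrigCurve.differentiable_param (f : TrigCurve N) : Differentiable ℝ f.param := fun φ =>
  (f.1.hasDerivAt_eval φ).differentiableAt.prodMk (f.2.hasDerivAt_eval φ).differentiableAt

theorem cos_ne_or_sin_ne {φ φ' : ℝ} (h : φ ∈ Set.Ico 0 (2 * Real.pi))
    (h' : φ' ∈ Set.Ico 0 (2 * Real.pi)) (hne : φ ≠ φ') :
    Real.cos φ ≠ Real.cos φ' ∨ Real.sin φ ≠ Real.sin φ' := by
  by_contra! hcon
  have h1 : Real.cos (φ - φ') = 1 := by
    rw [Real.cos_sub, hcon.1, hcon.2, ← sq, ← sq, Real.cos_sq_add_sin_sq]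
  refine hne (sub_eq_zero.1 ((Real.cos_eq_one_iff_of_lt_of_lt ?_ ?_).1 h1)) <;>
    linarith [h.1, h.2, h'.1, h'.2]

instance isAddHaarMeasure_volume_trigPoly : (volume : Measure (TrigPoly N)).IsAddHaarMeasure :=
  Measure.prod.instIsAddHaarMeasure _ _

instance isAddHaarMeasure_volume_trigCurve : (volume : Measure (TrigCurve N)).IsAddHaarMeasure :=
  Measure.prod.instIsAddHaarMeasure (volume : Measure (TrigPoly N)) volume

instance isAddHaarMeasure_volume_trigCurve_prod :
    (volume : Measure (TrigCurve N × TrigCurve N)).IsAddHaarMeasure :=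
  Measure.prod.instIsAddHaarMeasure (volume : Measure (TrigCurve N)) volume

theorem ae_encard_intersectionPoints (hN : N ≠ 0) :
    ∀ᵐ x : TrigCurve N × TrigCurve N, (intersectionPoints x.1 x.2).encard =
      {t : ℝ × ℝ | t ∈ Set.Ico 0 (2 * Real.pi) ×ˢ Set.Ico 0 (2 * Real.pi) ∧
        x.1.param t.1 = x.2.param t.2}.encard := by
  obtain ⟨M, rfl⟩ := Nat.exists_eq_succ_of_ne_zero hN
  let e₀ : TrigPoly (M + 1) := (Pi.single 0 1, 0)
  let e₁ : TrigPoly (M + 1) := (Pi.single 1 1, 0)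
  let e₂ : TrigPoly (M + 1) := (0, Pi.single 0 1)
  have h0 : ∀ φ, e₀.eval φ = 1 := fun φ => by
    simp [e₀, TrigPoly.eval_eq, Fin.succ_ne_zero]
  have h1 : ∀ φ, e₁.eval φ = Real.cos φ := fun φ => by
    rw [TrigPoly.eval, Finset.sum_eq_single 1]
    · simp [e₁]
    · intro j _ hj
      simp [e₁, hj]
    · simp
  have h2 : ∀ φ, e₂.eval φ = Real.sin φ := fun φ => by
    rw [TrigPoly.eval_eq, Finset.sum_eq_single 0]
    · simp [e₂]
    · intro j _ hj
      simp [e₂, hj]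
    · simp
  have key : ∀ e : TrigPoly (M + 1), ∀ᵐ x : TrigCurve (M + 1) × TrigCurve (M + 1),
      x ∉ doublePointCrossings (fun f φ => f.param φ) e.eval := fun e =>
    measure_eq_zero_iff_ae_notMem.1 (measure_doublePointCrossings volume
      TrigCurve.continuous_uncurry_param TrigCurve.differentiable_param
      (fun φ => (e.hasDerivAt_eval φ).differentiableAt) (TrigCurve.scale e) (TrigCurve.scale e₀)
      (fun f s φ => f.param_add_scale e s φ)
      (fun f s φ => by rw [f.param_add_scale e₀ s φ, h0, one_smul]))
  have hswap : ∀ e : TrigPoly (M + 1), ∀ᵐ x : TrigCurve (M + 1) × TrigCurve (M + 1),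
      x.swap ∉ doublePointCrossings (fun f φ => f.param φ) e.eval := fun e =>
    (Measure.measurePreserving_swap (μ := (volume : Measure (TrigCurve (M + 1))))
      (ν := (volume : Measure (TrigCurve (M + 1))))).quasiMeasurePreserving.ae (key e)
  filter_upwards [key e₁, key e₂, hswap e₁, hswap e₂] with x k1 k2 k3 k4
  rw [intersectionPoints_eq_image]
  refine Set.InjOn.encard_image ?_
  rintro ⟨φ, ψ⟩ ⟨⟨hφ, hψ⟩, ht⟩ ⟨φ', ψ'⟩ ⟨⟨hφ', hψ'⟩, ht'⟩ heq
  simp only at hφ hψ ht hφ' hψ' ht' heq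
  have e1 : φ = φ' := by
    by_contra hne
    rcases cos_ne_or_sin_ne hφ hφ' hne with h | h
    · exact k1 ⟨φ, φ', ψ, by rwa [h1, h1], heq, ht⟩
    · exact k2 ⟨φ, φ', ψ, by rwa [h2, h2], heq, ht⟩
  have e2 : ψ = ψ' := by
    by_contra hne
    have hg : x.2.param ψ = x.2.param ψ' := by rw [← ht, ← ht', heq]
    rcases cos_ne_or_sin_ne hψ hψ' hne with h | h
    · exact k3 ⟨ψ, ψ', φ, by rwa [h1, h1], hg, ht.symm⟩
    · exact k4 ⟨ψ, ψ', φ, by rwa [h2, h2], hg, ht.symm⟩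
  rw [e1, e2]

end Points

section Average

/-- The integral of a counting function is the sum of the measures of its level sets. -/
theorem tsum_mul_measure_level {X : Type*} [MeasurableSpace X] {μ : Measure X} {B : Set X}
    (hB : MeasurableSet B) {e : X → ℕ∞} {n : X → ℝ≥0∞} (hn : Measurable n)
    (h : ∀ᵐ x ∂μ.restrict B, n x = (e x : ℝ≥0∞)) (hfin : ∫⁻ x in B, n x ∂μ ≠ ⊤) :
    ∑' i : ℕ, (i : ℝ≥0∞) * μ {x | x ∈ B ∧ e x = (i : ℕ∞)} = ∫⁻ x in B, n x ∂μ := by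
  have hm : ∀ i : ℕ, MeasurableSet {x | n x = i} := fun i => hn (measurableSet_singleton _)
  have hlevel : ∀ i : ℕ, (i : ℝ≥0∞) * μ {x | x ∈ B ∧ e x = (i : ℕ∞)} =
      ∫⁻ x in B, {x | n x = i}.indicator (fun _ => (i : ℝ≥0∞)) x ∂μ := by
    intro i
    rw [lintegral_indicator_const (hm i), Measure.restrict_apply (hm i)]
    congr 1
    refine measure_congr ?_
    filter_upwards [(ae_restrict_iff' hB).1 h] with x hx
    refine propext ⟨fun hx' => ⟨?_, hx'.1⟩, fun hx' => ⟨hx'.2, ?_⟩⟩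
    · have h1 := hx hx'.1
      rw [hx'.2] at h1
      exact h1
    · have h1 := (hx hx'.2).symm.trans hx'.1
      exact_mod_cast h1
  simp_rw [hlevel]
  rw [← lintegral_tsum fun i => (measurable_const.indicator (hm i)).aemeasurable]
  refine lintegral_congr_ae ?_
  filter_upwards [h, ae_lt_top hn hfin] with x hx hlt
  have hne : e x ≠ ⊤ := by
    rintro h'
    rw [hx, h'] at hlt
    exact absurd hlt (by simp)
  obtain ⟨k, hk⟩ := ENat.ne_top_iff_exists.1 hne
  have hxk : n x = k := by rw [hx, ← hk]; rfl
  rw [tsum_eq_single k]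
  · simp [hxk]
  · intro i hi
    refine Set.indicator_of_notMem (fun h' => hi ?_) _
    have : (k : ℝ≥0∞) = i := hxk.symm.trans h'
    exact_mod_cast this.symm

theorem exists_map_linearEquiv_eq_smul {E F : Type*} [NormedAddCommGroup E] [NormedSpace ℝ E]
    [MeasurableSpace E] [BorelSpace E] [FiniteDimensional ℝ E] [NormedAddCommGroup F]
    [NormedSpace ℝ F] [MeasurableSpace F] [BorelSpace F] [FiniteDimensional ℝ F]
    (μ : Measure E) [μ.IsAddHaarMeasure] (ν : Measure F) [ν.IsAddHaarMeasure] (Λ : E ≃ₗ[ℝ] F) :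
    ∃ c : ℝ≥0∞, c ≠ 0 ∧ c ≠ ⊤ ∧ μ.map Λ = c • ν := by
  have : (μ.map Λ).IsAddHaarMeasure := Λ.toContinuousLinearEquiv.isAddHaarMeasure_map μ
  refine ⟨Measure.addHaarScalarFactor (μ.map Λ) ν, ?_, ENNReal.coe_ne_top,
    Measure.isAddLeftInvariant_eq_smul _ _⟩
  simpa only [ne_eq, ENNReal.coe_eq_zero] using
    (Measure.addHaarScalarFactor_pos_of_isAddHaarMeasure (μ.map Λ) ν).ne'

/-- The exact value of the average number of intersection points. -/
theorem averageIntersections_eq (r N : ℕ) :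
    averageIntersections r N = ENNReal.ofReal
      (meanCrossings (1 / 2 + weightSum r N 0) (weightSum r N 1) (2 * N)) := by
  have hκ : (0 : ℝ) < 1 / 2 := by norm_num
  have hdim : Module.finrank ℝ (FourierSpace N) = 2 * N := by
    simp [finrank_euclideanSpace, two_mul]
  obtain ⟨n, hn, hne, hint⟩ := exists_lintegral_encard_crossings hκ
    (hasDerivAt_fourierCurve r N) (continuous_fourierCurveDeriv r N)
    (fun φ => by rw [norm_sq_fourierCurve]) (norm_sq_fourierCurveDeriv r N)
    (inner_fourierCurve_deriv r N)
  rw [hdim] at hint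
  set mean := meanCrossings (1 / 2 + weightSum r N 0) (weightSum r N 1) (2 * N) with hmean
  set B : Set (TrigCurve N × TrigCurve N) := sobolevBall r N ×ˢ sobolevBall r N with hBdef
  set Λ := curvePairEquiv r N
  have hΛ : Measurable Λ := Λ.toContinuousLinearEquiv.continuous.measurable
  have hpre : Λ ⁻¹' curvePairBall (1 / 2) (FourierSpace N) = B := by
    ext x
    exact curvePairEquiv_mem_ball r x
  have hball := measurableSet_curvePairBall (H := FourierSpace N) (1 / 2)
  have hB : MeasurableSet B := hpre ▸ hΛ hball
  obtain ⟨c, hc0, hct, hmap⟩ := exists_map_linearEquiv_eq_smul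
    (volume : Measure (TrigCurve N × TrigCurve N))
    (volume : Measure (CurvePair (FourierSpace N))) Λ
  have hvol : volume B = c * volume (curvePairBall (1 / 2) (FourierSpace N)) := by
    rw [← hpre, ← Measure.map_apply hΛ hball, hmap, Measure.smul_apply, smul_eq_mul]
  have hlint : ∫⁻ x in B, n (Λ x) = ENNReal.ofReal mean * volume B := by
    rw [← hpre, ← setLIntegral_map hball hn hΛ, hmap, Measure.restrict_smul,
      lintegral_smul_measure, hint, hpre, hvol, smul_eq_mul]
    ring
  have hv0 : volume B ≠ 0 := by
    rw [hvol, volume_curvePairBall hκ]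
    refine mul_ne_zero hc0 (ENNReal.ofReal_pos.2 ?_).ne'
    have := Real.Gamma_pos_of_pos (s := (Module.finrank ℝ (FourierSpace N) : ℝ) + 2) (by positivity)
    have := Real.pi_pos
    positivity
  have hvt : volume B ≠ ⊤ := by
    rw [hvol, volume_curvePairBall hκ]
    exact ENNReal.mul_ne_top hct ENNReal.ofReal_ne_top
  have hfin : ∫⁻ x in B, n (Λ x) ≠ ⊤ := by
    rw [hlint]
    exact ENNReal.mul_ne_top ENNReal.ofReal_ne_top hvt
  have hcross : ∀ᵐ x : TrigCurve N × TrigCurve N,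
      n (Λ x) = ({t : ℝ × ℝ | t ∈ Set.Ico 0 (2 * Real.pi) ×ˢ Set.Ico 0 (2 * Real.pi) ∧
        x.1.param t.1 = x.2.param t.2}.encard : ℝ≥0∞) := by
    have h1 : ∀ᵐ ω ∂(volume : Measure (TrigCurve N × TrigCurve N)).map Λ,
        n ω = ((crossings (fourierCurve r N) ω).encard : ℝ≥0∞) := by
      rw [hmap]
      exact Measure.ae_smul_measure hne c
    filter_upwards [ae_of_ae_map hΛ.aemeasurable h1] with x hx
    rw [hx, crossings_curvePairEquiv]
  have hcount : ∀ᵐ x ∂volume.restrict B,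
      n (Λ x) = ((intersectionPoints x.1 x.2).encard : ℝ≥0∞) := by
    rcases eq_or_ne N 0 with hN | hN
    · have hzero : ∫⁻ x in B, n (Λ x) = 0 := by
        have : mean = 0 := by
          subst hN
          simp [hmean, meanCrossings, weightSum]
        rw [hlint, this]
        simp
      filter_upwards [(lintegral_eq_zero_iff (hn.comp hΛ)).1 hzero,
        ae_restrict_of_ae hcross] with x h0 hx
      have h0' : n (Λ x) = 0 := h0
      rw [h0'] at hx ⊢
      rw [intersectionPoints_eq_image]
      have hemp := Set.encard_eq_zero.1 (by exact_mod_cast hx.symm)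
      rw [hemp]
      simp
    · filter_upwards [ae_restrict_of_ae hcross, ae_restrict_of_ae (ae_encard_intersectionPoints hN)]
        with x hx hx'
      rw [hx, hx']
  unfold averageIntersections relativeVolume
  simp_rw [div_eq_mul_inv, ← mul_assoc]
  rw [ENNReal.tsum_mul_right, ← hBdef]
  have := tsum_mul_measure_level hB (hn.comp hΛ) hcount hfin
  rw [this]
  change (∫⁻ x in B, n (Λ x)) * _ = _
  rw [hlint, mul_assoc, ENNReal.mul_inv_cancel hv0 hvt, mul_one]

end Average

section Limits

theorem gamma_ratio_bounds (m : ℕ) :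
    1 ≤ Real.Gamma (m + 2) ^ 2 / ((m + 1) * Real.Gamma (m + 3 / 2) ^ 2) ∧
      Real.Gamma (m + 2) ^ 2 / ((m + 1) * Real.Gamma (m + 3 / 2) ^ 2) ≤
        1 + 1 / ((m : ℝ) + 1) := by
  have hm : (0 : ℝ) ≤ m := m.cast_nonneg
  have g1 : 0 < Real.Gamma (m + 1) := Real.Gamma_pos_of_pos (by positivity)
  have g2 : 0 < Real.Gamma (m + 2) := Real.Gamma_pos_of_pos (by positivity)
  have g3 : 0 < Real.Gamma (m + 3 / 2) := Real.Gamma_pos_of_pos (by positivity)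
  have g4 : 0 < Real.Gamma (m + 5 / 2) := Real.Gamma_pos_of_pos (by positivity)
  have logconvex : ∀ s t : ℝ, 0 < s → 0 < t →
      Real.Gamma ((s + t) / 2) ^ 2 ≤ Real.Gamma s * Real.Gamma t := by
    intro s t hs ht
    have h := Real.Gamma_mul_add_mul_le_rpow_Gamma_mul_rpow_Gamma hs ht
      (a := 1 / 2) (b := 1 / 2) (by norm_num) (by norm_num) (by norm_num)
    rw [show 1 / 2 * s + 1 / 2 * t = (s + t) / 2 by ring, ← Real.sqrt_eq_rpow,
      ← Real.sqrt_eq_rpow] at h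
    have hs' := (Real.Gamma_pos_of_pos hs).le
    have ht' := (Real.Gamma_pos_of_pos ht).le
    have hst := (Real.Gamma_pos_of_pos (show 0 < (s + t) / 2 by positivity)).le
    calc Real.Gamma ((s + t) / 2) ^ 2 ≤ (√(Real.Gamma s) * √(Real.Gamma t)) ^ 2 := by gcongr
      _ = Real.Gamma s * Real.Gamma t := by
        rw [mul_pow, Real.sq_sqrt hs', Real.sq_sqrt ht']
  have e2 : Real.Gamma (m + 2) = (m + 1) * Real.Gamma (m + 1) := by
    rw [← Real.Gamma_add_one (by positivity)]
    ring_nf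
  have e4 : Real.Gamma (m + 5 / 2) = (m + 3 / 2) * Real.Gamma (m + 3 / 2) := by
    rw [← Real.Gamma_add_one (by positivity)]
    ring_nf
  have h1 := logconvex (m + 1) (m + 2) (by positivity) (by positivity)
  have h2 := logconvex (m + 3 / 2) (m + 5 / 2) (by positivity) (by positivity)
  rw [show ((m : ℝ) + 1 + (m + 2)) / 2 = m + 3 / 2 by ring] at h1
  rw [show ((m : ℝ) + 3 / 2 + (m + 5 / 2)) / 2 = m + 2 by ring, e4] at h2
  constructor
  · rw [one_le_div (by positivity)]
    calc ((m : ℝ) + 1) * Real.Gamma (m + 3 / 2) ^ 2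
        ≤ (m + 1) * (Real.Gamma (m + 1) * Real.Gamma (m + 2)) := by gcongr
      _ = Real.Gamma (m + 2) ^ 2 := by rw [e2]; ring
  · rw [div_le_iff₀ (by positivity)]
    refine h2.trans ?_
    rw [show (1 + 1 / ((m : ℝ) + 1)) * ((m + 1) * Real.Gamma (m + 3 / 2) ^ 2) =
      (m + 2) * Real.Gamma (m + 3 / 2) ^ 2 by field_simp; ring]
    nlinarith [sq_nonneg (Real.Gamma (m + 3 / 2))]

theorem tendsto_gamma_ratio :
    Tendsto (fun m : ℕ => Real.Gamma (m + 2) ^ 2 / ((m + 1) * Real.Gamma (m + 3 / 2) ^ 2))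
      atTop (𝓝 1) := by
  refine tendsto_of_tendsto_of_tendsto_of_le_of_le tendsto_const_nhds ?_
    (fun m => (gamma_ratio_bounds m).1) (fun m => (gamma_ratio_bounds m).2)
  simpa using tendsto_one_div_add_atTop_nhds_zero_nat.const_add (1 : ℝ)

theorem weightSum_nonneg (r N s : ℕ) : 0 ≤ weightSum r N s :=
  Finset.sum_nonneg fun j _ => by
    have := sobolevWeight_pos r (j + 1)
    positivity

theorem averageIntersections_toReal (r N : ℕ) : (averageIntersections r N).toReal =
    Real.pi * (weightSum r N 1 / (1 / 2 + weightSum r N 0)) *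
      (Real.Gamma ((2 * N : ℕ) + 2) ^ 2 /
        (((2 * N : ℕ) + 1) * Real.Gamma ((2 * N : ℕ) + 3 / 2) ^ 2)) := by
  have h0 := weightSum_nonneg r N 0
  have h1 := weightSum_nonneg r N 1
  have hg := (gamma_ratio_bounds (2 * N)).1
  have hpi := Real.pi_pos
  rw [averageIntersections_eq, ENNReal.toReal_ofReal, meanCrossings]
  rw [meanCrossings]
  have := zero_le_one.trans hg
  positivity

theorem pow_le_sobolevWeight (r j : ℕ) : (j : ℝ) ^ (2 * r) ≤ sobolevWeight r j :=
  Finset.single_le_sum (f := fun q => (j : ℝ) ^ (2 * q)) (fun q _ => by positivity)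
    (Finset.self_mem_range_succ r)

theorem weight_term_le {r s j : ℕ} (h : s + 1 ≤ r) :
    ((j : ℝ) + 1) ^ (2 * s) / sobolevWeight r (j + 1) ≤
      1 / ((j : ℝ) + 1) ^ 2 * (1 / ((j : ℝ) + 1) ^ 2) ^ (r - s - 1) := by
  have h1 := pow_le_sobolevWeight r (j + 1)
  push_cast at h1
  have hj : (0 : ℝ) < j + 1 := by positivity
  obtain ⟨k, rfl⟩ := Nat.exists_eq_add_of_le h
  have hk : s + 1 + k - s - 1 = k := by omega
  rw [hk, div_le_iff₀ (sobolevWeight_pos _ _), one_div_pow]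
  calc ((j : ℝ) + 1) ^ (2 * s)
      = 1 / ((j : ℝ) + 1) ^ 2 * (1 / (((j : ℝ) + 1) ^ 2) ^ k) *
          ((j : ℝ) + 1) ^ (2 * (s + 1 + k)) := by
        generalize (j : ℝ) + 1 = y at hj
        rw [← pow_mul, mul_add, mul_add, pow_add, pow_add]
        field_simp
    _ ≤ _ := by gcongr

theorem summable_one_div_succ_sq : Summable fun j : ℕ => 1 / ((j : ℝ) + 1) ^ 2 := by
  have := (summable_nat_add_iff 1).2 (Real.summable_one_div_nat_pow.2 one_lt_two)
  simpa using this

theorem summable_weight {r s : ℕ} (h : s + 1 ≤ r) :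
    Summable fun j : ℕ => ((j : ℝ) + 1) ^ (2 * s) / sobolevWeight r (j + 1) := by
  refine summable_one_div_succ_sq.of_nonneg_of_le
    (fun j => by have := sobolevWeight_pos r (j + 1); positivity) fun j => ?_
  refine (weight_term_le h).trans (mul_le_of_le_one_right (by positivity) ?_)
  refine pow_le_one₀ (by positivity) ?_
  rw [div_le_one (by positivity)]
  exact one_le_pow₀ (by linarith [(j.cast_nonneg : (0 : ℝ) ≤ j)])

/-- The full sum of the `s`-th moments of the inverse weights. -/
noncomputable def weightLimit (r s : ℕ) : ℝ :=
  ∑' j : ℕ, ((j : ℝ) + 1) ^ (2 * s) / sobolevWeight r (j + 1)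

theorem tendsto_weightSum {r s : ℕ} (h : s + 1 ≤ r) :
    Tendsto (fun N => weightSum r N s) atTop (𝓝 (weightLimit r s)) :=
  (summable_weight h).hasSum.tendsto_sum_nat

theorem weightLimit_nonneg (r s : ℕ) : 0 ≤ weightLimit r s :=
  tsum_nonneg fun j => by have := sobolevWeight_pos r (j + 1); positivity

theorem sobolevWeight_one (r : ℕ) : sobolevWeight r 1 = r + 1 := by
  simp [sobolevWeight]

/-- The limit of the average number of intersection points as the degree grows. -/
noncomputable def averageLimit (r : ℕ) : ℝ :=
  Real.pi * (weightLimit r 1 / (1 / 2 + weightLimit r 0))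

theorem tendsto_gamma_ratio_two_mul :
    Tendsto (fun N : ℕ => Real.Gamma ((2 * N : ℕ) + 2) ^ 2 /
        (((2 * N : ℕ) + 1) * Real.Gamma ((2 * N : ℕ) + 3 / 2) ^ 2)) atTop (𝓝 1) :=
  tendsto_gamma_ratio.comp (tendsto_id.const_mul_atTop' two_pos)

theorem tendsto_averageIntersections {r : ℕ} (hr : 2 ≤ r) :
    Tendsto (fun N : ℕ => (averageIntersections r N).toReal) atTop (𝓝 (averageLimit r)) := by
  simp_rw [averageIntersections_toReal]
  have hP : 1 / 2 + weightLimit r 0 ≠ 0 := by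
    have := weightLimit_nonneg r 0
    positivity
  simpa [averageLimit] using (((tendsto_weightSum (s := 1) hr).div
    ((tendsto_weightSum (r := r) (s := 0) (by omega)).const_add (1 / 2)) hP).const_mul
      Real.pi).mul tendsto_gamma_ratio_two_mul

theorem isEquivalent_averageIntersections_one :
    (fun N : ℕ => (averageIntersections 1 N).toReal) ~[atTop]
      fun N : ℕ => Real.pi / (1 / 2 + weightLimit 1 0) * (N : ℝ) := by
  have hP : 0 < 1 / 2 + weightLimit 1 0 := by
    have := weightLimit_nonneg 1 0
    positivity
  have hterm : Tendsto (fun j : ℕ => ((j : ℝ) + 1) ^ (2 * 1) / sobolevWeight 1 (j + 1)) atTop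
      (𝓝 1) := by
    have h0 := (summable_weight (r := 1) (s := 0) le_rfl).tendsto_atTop_zero.const_sub 1
    rw [sub_zero] at h0
    refine h0.congr fun j => ?_
    have hw : sobolevWeight 1 (j + 1) = 1 + ((j : ℝ) + 1) ^ 2 := by
      simp [sobolevWeight, Finset.sum_range_succ]
    have : (1 : ℝ) + ((j : ℝ) + 1) ^ 2 ≠ 0 := by positivity
    rw [hw]
    field_simp
    ring
  have hQ : Tendsto (fun N : ℕ => (N : ℝ)⁻¹ * weightSum 1 N 1) atTop (𝓝 1) := hterm.cesaro
  have hP' := (tendsto_weightSum (r := 1) (s := 0) le_rfl).const_add (1 / 2)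
  have main := ((hQ.mul (hP'.inv₀ hP.ne')).const_mul (1 / 2 + weightLimit 1 0)).mul
    tendsto_gamma_ratio_two_mul
  rw [one_mul, mul_one, mul_inv_cancel₀ hP.ne'] at main
  refine isEquivalent_of_tendsto_one (main.congr fun N => ?_)
  have hpi := Real.pi_ne_zero
  rw [Pi.div_apply, averageIntersections_toReal]
  generalize Real.Gamma ((2 * N : ℕ) + 2) ^ 2 /
    (((2 * N : ℕ) + 1) * Real.Gamma ((2 * N : ℕ) + 3 / 2) ^ 2) = g
  have hP0 := hP.ne'
  generalize 1 / 2 + weightLimit 1 0 = p at hP0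
  generalize 1 / 2 + weightSum 1 N 0 = q
  rw [div_eq_mul_inv _ q, div_eq_mul_inv Real.pi p, div_eq_mul_inv, mul_inv, mul_inv, inv_inv]
  field_simp

theorem weightLimit_bounds : ∃ K : ℝ, 0 ≤ K ∧ ∀ r s : ℕ, s ≤ 1 → 2 ≤ r →
    0 ≤ weightLimit r s - 1 / ((r : ℝ) + 1) ∧
      weightLimit r s - 1 / ((r : ℝ) + 1) ≤ K * (1 / 4) ^ r := by
  have hsum : Summable fun j : ℕ => 1 / (((j + 1 : ℕ) : ℝ) + 1) ^ 2 :=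
    (summable_nat_add_iff 1).2 summable_one_div_succ_sq
  refine ⟨16 * ∑' j : ℕ, 1 / (((j + 1 : ℕ) : ℝ) + 1) ^ 2,
    mul_nonneg (by norm_num) (tsum_nonneg fun j => by positivity), fun r s hs hr => ?_⟩
  have hs' : s + 1 ≤ r := by omega
  have hsplit : weightLimit r s - 1 / ((r : ℝ) + 1) =
      ∑' j : ℕ, (((j + 1 : ℕ) : ℝ) + 1) ^ (2 * s) / sobolevWeight r (j + 1 + 1) := by
    rw [weightLimit, (summable_weight hs').tsum_eq_zero_add, zero_add, sobolevWeight_one]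
    simp
  rw [hsplit]
  refine ⟨tsum_nonneg fun j => ?_, ?_⟩
  · have := sobolevWeight_pos r (j + 1 + 1)
    positivity
  rw [mul_right_comm, ← tsum_mul_left]
  refine ((summable_nat_add_iff 1).2 (summable_weight hs')).tsum_le_tsum (fun j => ?_)
    (hsum.mul_left _)
  refine (weight_term_le hs').trans ?_
  rw [mul_comm]
  refine mul_le_mul_of_nonneg_right ?_ (by positivity)
  have hq : 1 / (((j + 1 : ℕ) : ℝ) + 1) ^ 2 ≤ 1 / 4 := by
    refine one_div_le_one_div_of_le (by norm_num) ?_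
    push_cast
    nlinarith [(j.cast_nonneg : (0 : ℝ) ≤ j)]
  calc (1 / (((j + 1 : ℕ) : ℝ) + 1) ^ 2) ^ (r - s - 1) ≤ (1 / 4 : ℝ) ^ (r - s - 1) :=
        pow_le_pow_left₀ (by positivity) hq _
    _ ≤ (1 / 4 : ℝ) ^ (r - 2) := pow_le_pow_of_le_one (by norm_num) (by norm_num) (by omega)
    _ = 16 * (1 / 4) ^ r := by
        obtain ⟨k, rfl⟩ := Nat.exists_eq_add_of_le hr
        rw [Nat.add_sub_cancel_left, pow_add]
        norm_num [← mul_assoc]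

theorem averageLimit_pos {r : ℕ} (hr : 2 ≤ r) : 0 < averageLimit r := by
  obtain ⟨K, -, hK⟩ := weightLimit_bounds
  have h1 := (hK r 1 le_rfl hr).1
  have h0 := weightLimit_nonneg r 0
  have h2 : 0 < 1 / ((r : ℝ) + 1) := by positivity
  have h3 : 0 < weightLimit r 1 := by linarith
  have := Real.pi_pos
  unfold averageLimit
  positivity

theorem averageLimit_sub_bound : ∃ K : ℝ, 0 ≤ K ∧ ∀ r : ℕ, 2 ≤ r →
    |averageLimit r - 2 * Real.pi / ((r : ℝ) + 3)| ≤ K * (1 / 4) ^ r := by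
  obtain ⟨K, hK0, hK⟩ := weightLimit_bounds
  have hpi := Real.pi_pos
  refine ⟨Real.pi * (6 * K), by positivity, fun r hr => ?_⟩
  obtain ⟨e0, e1⟩ := hK r 1 le_rfl hr
  obtain ⟨d0, d1⟩ := hK r 0 zero_le_one hr
  set x : ℝ := 1 / ((r : ℝ) + 1) with hx
  set ε := weightLimit r 1 - x with hε
  set δ := weightLimit r 0 - x with hδ
  set η := K * (1 / 4) ^ r with hη
  have hη0 : 0 ≤ η := by positivity
  have hx0 : 0 < x := by positivity
  have hx1 : x ≤ 1 := by
    rw [hx, div_le_one (by positivity)]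
    linarith [(r.cast_nonneg : (0 : ℝ) ≤ r)]
  have hlim : 2 * Real.pi / ((r : ℝ) + 3) = Real.pi * (x / (1 / 2 + x)) := by
    rw [hx]
    field_simp
    ring
  have hL : averageLimit r = Real.pi * ((x + ε) / (1 / 2 + x + δ)) := by
    rw [averageLimit, hε, hδ]
    ring_nf
  have hdiff : (x + ε) / (1 / 2 + x + δ) - x / (1 / 2 + x) =
      (ε * (1 / 2 + x) - x * δ) / ((1 / 2 + x + δ) * (1 / 2 + x)) := by
    rw [div_sub_div _ _ (by positivity) (by positivity)]
    ring_nf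
  rw [hL, hlim, ← mul_sub, abs_mul, abs_of_pos hpi, mul_assoc, mul_assoc, ← hη, hdiff, abs_div,
    abs_of_pos (show 0 < (1 / 2 + x + δ) * (1 / 2 + x) by positivity)]
  refine mul_le_mul_of_nonneg_left ?_ hpi.le
  rw [div_le_iff₀ (by positivity)]
  have hden : 1 / 4 ≤ (1 / 2 + x + δ) * (1 / 2 + x) := by nlinarith [mul_nonneg d0 hx0.le]
  have hnum : |ε * (1 / 2 + x) - x * δ| ≤ 3 / 2 * η := by
    have a1 : ε * (1 / 2 + x) ≤ 3 / 2 * η := by nlinarith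
    have a2 : x * δ ≤ η := by nlinarith
    have a3 : 0 ≤ ε * (1 / 2 + x) := by positivity
    have a4 : 0 ≤ x * δ := by positivity
    rw [abs_le]
    constructor <;> linarith
  nlinarith

theorem tendsto_pow_mul_averageLimit_sub (k : ℕ) :
    Tendsto (fun r : ℕ => (r : ℝ) ^ k * (averageLimit r - 2 * Real.pi / ((r : ℝ) + 3))) atTop
      (𝓝 0) := by
  obtain ⟨K, -, hK⟩ := averageLimit_sub_bound
  have h := (tendsto_pow_const_mul_const_pow_of_abs_lt_one k
    (show |(1 / 4 : ℝ)| < 1 by rw [abs_of_pos] <;> norm_num)).const_mul K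
  rw [mul_zero] at h
  refine squeeze_zero_norm' ?_ h
  filter_upwards [eventually_ge_atTop 2] with r hr
  rw [Real.norm_eq_abs, abs_mul, abs_of_nonneg (by positivity : (0 : ℝ) ≤ (r : ℝ) ^ k)]
  calc (r : ℝ) ^ k * |averageLimit r - 2 * Real.pi / ((r : ℝ) + 3)|
      ≤ (r : ℝ) ^ k * (K * (1 / 4) ^ r) := by gcongr; exact hK r hr
    _ = _ := by ring

theorem isEquivalent_averageLimit :
    averageLimit ~[atTop] fun r : ℕ => 2 * Real.pi / (r : ℝ) := by
  have hpi := Real.pi_pos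
  refine isEquivalent_of_tendsto_one ?_
  have h := ((tendsto_pow_mul_averageLimit_sub 1).div_const (2 * Real.pi)).add
    (tendsto_natCast_div_add_atTop (3 : ℝ))
  rw [zero_div, zero_add] at h
  refine h.congr' ?_
  filter_upwards [eventually_gt_atTop 0] with r hr
  have : (0 : ℝ) < r := by exact_mod_cast hr
  simp only [Pi.div_apply]
  field_simp
  ring

theorem isEquivalent_averageLimit_sub :
    (fun r : ℕ => averageLimit r - averageLimit (r + 1)) ~[atTop]
      fun r : ℕ => 2 * Real.pi / (r : ℝ) ^ 2 := by
  have hpi := Real.pi_pos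
  refine isEquivalent_of_tendsto_one ?_
  have h1 := (tendsto_pow_mul_averageLimit_sub 2).comp (tendsto_add_atTop_nat 1)
  have h2 := h1.mul ((tendsto_natCast_div_add_atTop (1 : ℝ)).pow 2)
  have h3 := (((tendsto_pow_mul_averageLimit_sub 2).sub h2).div_const (2 * Real.pi)).add
    ((tendsto_natCast_div_add_atTop (3 : ℝ)).mul (tendsto_natCast_div_add_atTop (4 : ℝ)))
  simp only [zero_mul, sub_zero, zero_div, zero_add, mul_one] at h3
  refine h3.congr' ?_
  filter_upwards [eventually_gt_atTop 0] with r hr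
  have : (0 : ℝ) < r := by exact_mod_cast hr
  simp only [Pi.div_apply, Function.comp_apply]
  push_cast
  field_simp
  ring

end Limits

end

theorem mainTheorem5 :
    (∀ r N : ℕ, 1 ≤ r → averageIntersections r N ≠ ⊤) ∧
    (∃ c : ℝ, 0 < c ∧
      (fun N : ℕ => (averageIntersections 1 N).toReal) ~[atTop] (fun N : ℕ => c * (N : ℝ))) ∧
    (∃ L : ℕ → ℝ,
      (∀ r : ℕ, 2 ≤ r → 0 < L r ∧
        Tendsto (fun N : ℕ => (averageIntersections r N).toReal) atTop (𝓝 (L r))) ∧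
      L ~[atTop] (fun r : ℕ => 2 * Real.pi / (r : ℝ)) ∧
      (fun r : ℕ => L r - L (r + 1)) ~[atTop] (fun r : ℕ => 2 * Real.pi / (r : ℝ) ^ 2)) := by
  exact ⟨fun r N _ => averageIntersections_eq r N ▸ ENNReal.ofReal_ne_top,
    ⟨Real.pi / (1 / 2 + weightLimit 1 0),
      div_pos Real.pi_pos (add_pos_of_pos_of_nonneg one_half_pos (weightLimit_nonneg 1 0)),
      isEquivalent_averageIntersections_one⟩,
    ⟨averageLimit, fun r hr => ⟨averageLimit_pos hr, tendsto_averageIntersections hr⟩,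
      isEquivalent_averageLimit, isEquivalent_averageLimit_sub⟩⟩
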